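/- **Model.** An instance $\mathcal I$ consists of $n$ opportunities with capacities $c_1,\dots,c_n\in\mathbb N$ and a sequence of $T$ volunteers. Volunteer $t$ is either internal or external and has conversion probabilities $\mu_{i,t}\in[0,1]$. An external volunteer has a targeted opportunity $i_t^*$, with $\mu_{i_t^*,t}=1$, and always signs up for it. To an internal volunteer the platform recommends an opportunity $i$ (or none, the dummy opportunity $0$), and the volunteer then signs up for $i$ with probability $\mu_{i,t}$, independently of the past. The expected value $\pi(\mathcal I)$ of a policy $\pi$ is $\mathbb E\big[\sum_i\min\{c_i,\#\text{sign-ups for }i\}\big]$. An online algorithm bases its recommendation on the capacities, the past arrivals and decisions, and the type of the current volunteer. $\mathrm{OPT}(\mathcal I)$ is the maximal expected value of an adaptive policy that knows the whole arrival sequence in advance but observes sign-up decisions only as they happen. The effective fraction of external traffic (EFET) of $\mathcal I$ is $\sum_i\min\{c_i,\#\{t \text{ external}: i_t^*=i\}\}\big/\sum_i c_i$. The maximum conversion probability ratio (MCPR) of $\mathcal I$ is the maximum over $t$ of $\max_{i:\mu_{i,t}>0}\mu_{i,t}\big/\min_{i:\mu_{i,t}>0}\mu_{i,t}$. **Algorithm.**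 Let $\psi(x)=1-e^{x-1}$. The Adaptive Capacity (AC) algorithm keeps for every $i$ the amounts $\mathrm{AC}^{\mathrm{ext}}_i$ and $\mathrm{AC}^{\mathrm{int}}_i$ of the capacity of $i$ filled so far by external and by internal volunteers, and the fill rate $\mathrm{FR}_i=\mathrm{AC}^{\mathrm{int}}_i/(c_i-\mathrm{AC}^{\mathrm{ext}}_i)$, with $\mathrm{FR}_i=1$ if $\mathrm{AC}^{\mathrm{ext}}_i=c_i$. To an internal volunteer $t$ it recommends the opportunity that maximizes $\mu_{i,t}\,\psi(\mathrm{FR}_i)$; the dummy opportunity $0$ has weight $0$, and ties are broken in favour of the lowest index. **Theorem 3.** Let $\beta\in[0,1]$, let $\underline c\ge 1$ be an integer and let $\sigma\ge 1$. Let $\mathcal D=\{(x_1,x_2)\in\mathbb R^2_{\ge 0}:x_1+x_2\le 1\}$, let $$g(x_1,x_2)=1-\tfrac1e+x_1+(1-x_1)\,\psi\!\left(\tfrac{x_2}{1-x_1}\right)-\psi(x_2)$$ on $\mathcal D$ (where the product $(1-x_1)\psi(\cdot)$ is $0$ at $x_1=1$), and let $\breve g$ be the lower convex envelope of $g$ on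 $\mathcal D$, i.e. the supremum of all convex functions on $\mathcal D$ that are at most $g$. Then the set of all $z\in[0,1]$ with $$z\ge e^{-1/\underline c}(1-1/e)\quad\text{and}\quad z\ge e^{-1/\underline c}\,\breve g\big(\max\{0,\beta-\sigma+z\},\;z-\max\{0,\beta-\sigma+z\}\big)$$ has a smallest element $z^*$, and, over all instances with EFET equal to $\beta$, smallest capacity equal to $\underline c$ and MCPR at most $\sigma$, the competitive ratio of AC is at least $\max\{\beta,z^*\}$; that is, $$\inf_{\mathcal I}\ \frac{\mathrm{AC}(\mathcal I)}{\mathrm{OPT}(\mathcal I)}\ \ge\ \max\{\beta,z^*\},$$ where the infimum runs over all such instances with $\mathrm{OPT}(\mathcal I)>0$. -/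

import Mathlib

noncomputable section

namespace MultiChannel

/-- The type of a volunteer on a platform with `n` opportunities.
`target = none` means internal traffic, `target = some i` means external traffic that
automatically views opportunity `i`.  `μ i` is the probability of signing up for `i` after
viewing `i`; external traffic signs up for its target with probability one. -/
structure Volunteer (n : ℕ) where
  target : Option (Fin n)
  μ : Fin n → ℝ
  μ_mem : ∀ i, μ i ∈ Set.Icc (0 : ℝ) 1
  μ_target : ∀ i, target = some i → μ i = 1

/-- A problem instance: `n` opportunities with integer capacities, and a sequence of `T`
arriving volunteers. -/
structure Problem where
  n : ℕ
  cap : Fin n → ℕ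
  T : ℕ
  vol : Fin T → Volunteer n

/-- The history of arrivals and sign-up decisions, most recent first.  The decision `some i` is a
sign-up for `i`; the decision `none` (the dummy opportunity) is the absence of a sign-up. -/
abbrev History (n : ℕ) := List (Volunteer n × Option (Fin n))

/-- A (deterministic, adaptive) rule that recommends an opportunity, or none, given the history and
the type of the arriving volunteer. -/
abbrev Policy (n : ℕ) := History n → Volunteer n → Option (Fin n)

/-- An online algorithm knows the capacities, the history and the current volunteer only. -/
abbrev OnlineAlgorithm := (n : ℕ) → (Fin n → ℕ) → Policy n

namespace Problem

variable (I : Problem)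

/-- A sample path: `ω t i` tells whether volunteer `t` signs up for `i` when `i` is recommended. -/
abbrev Path := Fin I.T → Fin I.n → Bool

/-- The probability of a sample path; its components are independent Bernoulli variables with
parameters `μ`. -/
def prob (ω : I.Path) : ℝ :=
  ∏ t, ∏ i, if ω t i then (I.vol t).μ i else 1 - (I.vol t).μ i

/-- Expectation over the sample paths. -/
def expect (f : I.Path → ℝ) : ℝ := ∑ ω, I.prob ω * f ω

end Problem

/-- The sign-up decision of volunteer `v` with realizations `w` when the platform recommends `r`.
External traffic ignores `r` and deterministically signs up for its target. -/
def decision {n : ℕ} (v : Volunteer n) (w : Fin n → Bool) (r : Option (Fin n)) :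
    Option (Fin n) :=
  match v.target with
  | some j => some j
  | none =>
    match r with
    | some i => if w i then some i else none
    | none => none

namespace Problem

variable (I : Problem)

/-- The history after the first `t` arrivals, when policy `π` is followed along the path `ω`. -/
def history (π : Policy I.n) (ω : I.Path) : ℕ → History I.n
  | 0 => []
  | t + 1 =>
    if h : t < I.T then
      (I.vol ⟨t, h⟩,
        decision (I.vol ⟨t, h⟩) (ω ⟨t, h⟩) (π (history π ω t) (I.vol ⟨t, h⟩))) :: history π ω t
    else history π ω t

/-- The number of sign-ups for opportunity `i` over the whole horizon. -/
def signups (π : Policy I.n) (ω : I.Path) (i : Fin I.n) : ℕ :=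
  ((I.history π ω I.T).map Prod.snd).count (some i)

/-- The expected amount of filled capacity under policy `π`; sign-ups beyond capacity are
worthless. -/
def value (π : Policy I.n) : ℝ :=
  I.expect fun ω => ∑ i, (min (I.cap i) (I.signups π ω i) : ℝ)

/-- The value of the optimal clairvoyant algorithm: the policy is chosen with knowledge of the whole
instance, but it observes sign-up decisions only as they happen. -/
def opt : ℝ := ⨆ π : Policy I.n, I.value π

/-- The number of external volunteers that target opportunity `i`. -/
def external (i : Fin I.n) : ℕ :=
  (Finset.univ.filter fun t => (I.vol t).target = some i).card

/-- The effective fraction of external traffic. -/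
def efet : ℝ := (∑ i, (min (I.cap i) (I.external i) : ℝ)) / ∑ i, (I.cap i : ℝ)

/-- The conversion probability ratio of volunteer `t`: the largest over the smallest of its positive
conversion probabilities. -/
def cpr (t : Fin I.T) : ℝ :=
  (⨆ i : {i : Fin I.n // 0 < (I.vol t).μ i}, (I.vol t).μ i) /
    ⨅ i : {i : Fin I.n // 0 < (I.vol t).μ i}, (I.vol t).μ i

/-- The maximum conversion probability ratio. -/
def mcpr : ℝ := ⨆ t, I.cpr t

end Problem

/-- The competitive ratio of `A` over a class `C` of instances: the infimum, over the instances of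
`C` with positive optimum, of the ratio between the values of `A` and of the optimal clairvoyant
algorithm. -/
def competitiveRatio (A : OnlineAlgorithm) (C : Set Problem) : EReal :=
  ⨅ I ∈ {I ∈ C | 0 < I.opt}, ((I.value (A I.n I.cap) / I.opt : ℝ) : EReal)

/-- The trade-off function. -/
def psi (x : ℝ) : ℝ := 1 - Real.exp (x - 1)

/-- The counters of the Adaptive Capacity algorithm: capacity filled by external and by internal
traffic. -/
structure Counters (n : ℕ) where
  ext : Fin n → ℕ
  int : Fin n → ℕ

/-- The update of the counters after volunteer `a.1` made the decision `a.2`. -/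
def Counters.update {n : ℕ} (cap : Fin n → ℕ) (a : Volunteer n × Option (Fin n))
    (s : Counters n) : Counters n :=
  match a.1.target with
  | some _ =>
    { ext := fun i => min (cap i - s.int i) (s.ext i + if a.2 = some i then 1 else 0)
      int := s.int }
  | none =>
    { ext := s.ext
      int := fun i => min (cap i - s.ext i) (s.int i + if a.2 = some i then 1 else 0) }

/-- The counters after a history. -/
def counters {n : ℕ} (cap : Fin n → ℕ) (H : History n) : Counters n :=
  H.foldr (Counters.update cap) ⟨fun _ => 0, fun _ => 0⟩

/-- The fill rate: internally filled capacity over the capacity not filled externally.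
An opportunity that is completely filled by external traffic is full, so its fill rate is one. -/
def fillRate {n : ℕ} (cap : Fin n → ℕ) (s : Counters n) (i : Fin n) : ℝ :=
  if cap i ≤ s.ext i then 1 else (s.int i : ℝ) / ((cap i : ℝ) - (s.ext i : ℝ))

/-- The weighted conversion probability of an opportunity; it is zero for the dummy opportunity. -/
def acWeight {n : ℕ} (cap : Fin n → ℕ) (s : Counters n) (v : Volunteer n) :
    Option (Fin n) → ℝ
  | none => 0
  | some i => v.μ i * psi (fillRate cap s i)

/-- The Adaptive Capacity algorithm: external traffic is sent to its target; internal traffic is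
sent to an opportunity of maximal weight, ties being broken in favour of the first in the list
dummy, `0`, `1`, `2`, ... (`List.argmax` returns the first maximizer). -/
def adaptiveCapacity : OnlineAlgorithm := fun n cap H v =>
  match v.target with
  | some j => some j
  | none =>
    (List.argmax (acWeight cap (counters cap H) v)
      (none :: (List.finRange n).map some)).getD none

/-- The lower convex envelope of `g` on `D`: the supremum of the functions that are convex on `D`
and at most `g` there. -/
def lowerConvexEnvelope (D : Set (ℝ × ℝ)) (g : ℝ × ℝ → ℝ) (x : ℝ × ℝ) : ℝ :=
  sSup {y | ∃ h : ℝ × ℝ → ℝ, ConvexOn ℝ D h ∧ (∀ p ∈ D, h p ≤ g p) ∧ y = h x}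

/-- The domain of `gFun`. -/
def simplexDomain : Set (ℝ × ℝ) := {p | 0 ≤ p.1 ∧ 0 ≤ p.2 ∧ p.1 + p.2 ≤ 1}

/-- `g(x₁, x₂) = 1 - 1/e + x₁ + (1 - x₁) ψ(x₂ / (1 - x₁)) - ψ(x₂)`; the product is zero at
`x₁ = 1`. -/
def gFun (p : ℝ × ℝ) : ℝ :=
  1 - 1 / Real.exp 1 + p.1 + (1 - p.1) * psi (p.2 / (1 - p.1)) - psi p.2

/-- The lower convex envelope of `gFun` on the simplex. -/
def gEnv : ℝ × ℝ → ℝ := lowerConvexEnvelope simplexDomain gFun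

/-- The feasible set of the program that defines `zStar`. -/
def feasible (β : ℝ) (c : ℕ) (σ : ℝ) : Set ℝ :=
  {z | z ∈ Set.Icc (0 : ℝ) 1 ∧
    Real.exp (-1 / (c : ℝ)) * (1 - 1 / Real.exp 1) ≤ z ∧
    Real.exp (-1 / (c : ℝ)) * gEnv (max 0 (β - σ + z), z - max 0 (β - σ + z)) ≤ z}

/-- The optimal value of that program. -/
def zStar (β : ℝ) (c : ℕ) (σ : ℝ) : ℝ := sInf (feasible β c σ)

/-- The instances with effective fraction of external traffic `β`, smallest capacity `c`, and
maximum conversion probability ratio at most `σ`. -/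
def instanceClass (β : ℝ) (c : ℕ) (σ : ℝ) : Set Problem :=
  {I | I.efet = β ∧ IsLeast (Set.range I.cap) c ∧ I.mcpr ≤ σ}

end MultiChannel

end

namespace MultiChannel

/-! The proof is a primal-dual accounting against one fixed policy. `exists_fractional` replaces the
policy by a fractional assignment `y` of internal volunteers; opportunity `i` then has an optimal
fill `o i` (its external part plus what `y` adds), and the sum `O` of these bounds the value of the
policy. Every internal sign-up of volunteer `t` under AC carries the weight `Y t = ∑ j, y t j`,
split into shares `ψ(FR)` and `1 - ψ(FR)`. Since AC maximizes `μ ψ(FR)` and fill rates only grow,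
the first shares pay for `y` at the final fill rates (`volunteer_reward`). The second shares add up
to an exponential potential of the weighted fill, up to a discretization factor `e^{-1/c}`
(`credited_reward`). All remaining fill, external or unweighted, counts in full.

On a fixed path and opportunity, let `x₁` and `x₂` be the fully counted and the weighted fill
relative to `o i`, after discarding excess fill. `exists_gFun_le` shows that the account is worth at
least `o i * g(x₁, x₂)`. Jensen's inequality over pairs (path, opportunity) gives `e^{-1/c} * gEnv p
≤ z` at the mean point `p`, where `z` is the undiscarded value of AC divided by `O`. The parameters
`β` and `σ` enter through one estimate: the weighted fill is at most `σ` times what `y` adds, hence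
at most `(σ - β) O`. So `p.1 ≥ z - (σ - β)` and `p.1 + p.2 ≤ z`. The envelope decreases along the
moves from `p` to the point in the program (`gEnv_anti_snd`, `gEnv_trade`), so `z` is feasible if it
is at most one, and `zStar ≤ z`.

The bound by `β` is separate: AC always fills at least the capacity that external traffic alone can
fill. -/

/-! ### The functions `psi` and `gFun`: closed form and monotonicity. -/

theorem psi_one : psi 1 = 0 := by simp [psi]

theorem psi_nonneg {x : ℝ} (hx : x ≤ 1) : 0 ≤ psi x := by
  have : Real.exp (x - 1) ≤ 1 := by rw [Real.exp_le_one_iff]; linarith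
  simp only [psi]; linarith

theorem psi_antitone : Antitone psi := by
  intro x y h
  have : Real.exp (x - 1) ≤ Real.exp (y - 1) := Real.exp_le_exp.2 (by linarith)
  simp only [psi]; linarith

/-- The closed form of the trade-off function on the simplex. -/
theorem gFun_eq (p : ℝ × ℝ) :
    gFun p = 1 - Real.exp (-1) + Real.exp (p.2 - 1)
      - (1 - p.1) * Real.exp (p.2 / (1 - p.1) - 1) := by
  simp only [gFun, psi, Real.exp_neg, one_div]; ring

/-- The derivative in `b` is `exp (x / b) * (1 - x / b)`, nonnegative for `b ≥ x`; the proof uses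
the tangent line of `exp` instead. It yields the growth of `gFun` in the first coordinate, with `b =
1 - p.1`. -/
theorem mul_exp_div_le_mul_exp_div {b b' x : ℝ} (hb : 0 < b) (hbb : b ≤ b') (hx : x ≤ b) :
    b * Real.exp (x / b) ≤ b' * Real.exp (x / b') := by
  have hb' : 0 < b' := by linarith
  have h1 : x / b' - x / b + 1 ≤ Real.exp (x / b' - x / b) := Real.add_one_le_exp _
  have h2 : Real.exp (x / b') = Real.exp (x / b) * Real.exp (x / b' - x / b) := by
    rw [← Real.exp_add]; ring_nf
  have h3 : b ≤ b' * (x / b' - x / b + 1) := by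
    have e : b' * (x / b' - x / b + 1) - b = (b' - b) * (1 - x / b) := by field_simp; ring
    have : x / b ≤ 1 := (div_le_one hb).2 hx
    nlinarith [mul_nonneg (sub_nonneg.2 hbb) (sub_nonneg.2 this)]
  rw [h2]
  calc b * Real.exp (x / b) ≤ (b' * Real.exp (x / b' - x / b)) * Real.exp (x / b) := by
        gcongr
        exact h3.trans (by gcongr)
    _ = _ := by ring

/-- The derivative in `x` is `exp x - exp (x / b) ≤ 0`. For an increment `d`, convexity of `exp`
gives `exp d - 1 ≤ b * (exp (d / b) - 1)`. It yields the decrease of `gFun` in the second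
coordinate. -/
theorem exp_sub_mul_exp_div_le {b x y : ℝ} (hb : 0 < b) (hb1 : b ≤ 1) (hx : 0 ≤ x)
    (hxy : x ≤ y) :
    Real.exp y - b * Real.exp (y / b) ≤ Real.exp x - b * Real.exp (x / b) := by
  obtain ⟨d, rfl⟩ : ∃ d, y = x + d := ⟨y - x, by ring⟩
  have hd : 0 ≤ d := by linarith
  have hc := convexOn_exp.2 (Set.mem_univ (d / b)) (Set.mem_univ 0) hb.le
    (sub_nonneg.2 hb1) (by ring)
  simp only [smul_eq_mul, mul_zero, add_zero, Real.exp_zero, mul_one] at hc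
  rw [mul_div_cancel₀ _ hb.ne'] at hc
  have h1 : Real.exp x ≤ Real.exp (x / b) := Real.exp_le_exp.2 (by
    rw [le_div_iff₀ hb]; nlinarith)
  have h2 : 0 ≤ Real.exp d - 1 := by linarith [Real.add_one_le_exp d]
  rw [add_div, Real.exp_add, Real.exp_add]
  nlinarith [mul_le_mul h1 (show Real.exp d - 1 ≤ b * (Real.exp (d / b) - 1) by linarith) h2
    (Real.exp_pos _).le]

theorem gFun_mono {p q : ℝ × ℝ} (hp : p ∈ simplexDomain) (hq : q ∈ simplexDomain)
    (h1 : q.1 ≤ p.1) (h2 : p.2 ≤ q.2) : gFun q ≤ gFun p := by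
  obtain ⟨hp1, hp2, hp3⟩ := hp
  obtain ⟨hq1, hq2, hq3⟩ := hq
  have e : ∀ b x : ℝ, Real.exp (x - 1) - b * Real.exp (x / b - 1) =
      Real.exp (-1) * (Real.exp x - b * Real.exp (x / b)) := by
    intro b x; simp only [sub_eq_add_neg, Real.exp_add]; ring
  have key : Real.exp q.2 - (1 - q.1) * Real.exp (q.2 / (1 - q.1)) ≤
      Real.exp p.2 - (1 - p.1) * Real.exp (p.2 / (1 - p.1)) := by
    rcases (show p.1 ≤ 1 by linarith).eq_or_lt with h | h
    · have hp20 : p.2 = 0 := by linarith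
      rw [h, hp20]
      rcases (show q.1 ≤ 1 by linarith).eq_or_lt with h' | h'
      · have hq20 : q.2 = 0 := by linarith
        rw [h', hq20]
      · have := exp_sub_mul_exp_div_le (b := 1 - q.1) (by linarith) (by linarith) le_rfl hq2
        simp at this ⊢; linarith
    · have hb : 0 < 1 - p.1 := by linarith
      have a1 := exp_sub_mul_exp_div_le (b := 1 - q.1) (by linarith) (by linarith) hp2 h2
      have a2 := mul_exp_div_le_mul_exp_div hb (show 1 - p.1 ≤ 1 - q.1 by linarith)
        (show p.2 ≤ 1 - p.1 by linarith)
      linarith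
  rw [gFun_eq, gFun_eq]
  have := mul_le_mul_of_nonneg_left key (Real.exp_pos (-1)).le
  rw [← e, ← e] at this
  linarith

theorem gFun_zero_left (x : ℝ) : gFun (0, x) = 1 - 1 / Real.exp 1 := by
  rw [gFun_eq]; simp [Real.exp_neg]

theorem gFun_one_zero : gFun (1, 0) = 1 := by
  rw [gFun_eq]; simp

theorem le_gFun {p : ℝ × ℝ} (hp : p ∈ simplexDomain) : 1 - 1 / Real.exp 1 ≤ gFun p := by
  rw [← gFun_zero_left p.2]
  exact gFun_mono hp ⟨le_rfl, hp.2.1, by simpa using (by linarith [hp.1, hp.2.2] : p.2 ≤ 1)⟩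
    hp.1 le_rfl

theorem gFun_le_one {p : ℝ × ℝ} (hp : p ∈ simplexDomain) : gFun p ≤ 1 := by
  rw [← gFun_one_zero]
  exact gFun_mono ⟨by norm_num, le_rfl, by norm_num⟩ hp (by linarith [hp.2.1, hp.2.2]) hp.2.1

/-! ### The lower convex envelope and its monotonicity. -/

theorem convex_simplexDomain : Convex ℝ simplexDomain := by
  intro x hx y hy a b ha hb hab
  obtain ⟨h1, h2, h3⟩ := hx
  obtain ⟨h4, h5, h6⟩ := hy
  refine ⟨?_, ?_, ?_⟩
  · simp; positivity
  · simp; positivity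
  · simp only [Prod.fst_add, Prod.snd_add, Prod.smul_fst, Prod.smul_snd, smul_eq_mul]
    nlinarith

theorem le_gEnv {h : ℝ × ℝ → ℝ} (hc : ConvexOn ℝ simplexDomain h)
    (hg : ∀ p ∈ simplexDomain, h p ≤ gFun p) {p : ℝ × ℝ} (hp : p ∈ simplexDomain) :
    h p ≤ gEnv p := by
  refine le_csSup ⟨gFun p, ?_⟩ ⟨h, hc, hg, rfl⟩
  rintro y ⟨k, -, hk, rfl⟩
  exact hk p hp

theorem gEnv_le {p : ℝ × ℝ} {a : ℝ} (H : ∀ h : ℝ × ℝ → ℝ, ConvexOn ℝ simplexDomain h →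
    (∀ p ∈ simplexDomain, h p ≤ gFun p) → h p ≤ a) : gEnv p ≤ a := by
  refine csSup_le ⟨_, fun _ => 1 - 1 / Real.exp 1, convexOn_const _ convex_simplexDomain,
    fun p hp => le_gFun hp, rfl⟩ ?_
  rintro y ⟨k, hk, hk', rfl⟩
  exact H k hk hk'

theorem le_gEnv_const {p : ℝ × ℝ} (hp : p ∈ simplexDomain) : 1 - 1 / Real.exp 1 ≤ gEnv p :=
  le_gEnv (h := fun _ => 1 - 1 / Real.exp 1) (convexOn_const _ convex_simplexDomain)
    (fun _ hp => le_gFun hp) hp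

theorem gEnv_le_gFun {p : ℝ × ℝ} (hp : p ∈ simplexDomain) : gEnv p ≤ gFun p :=
  gEnv_le fun _ _ h => h p hp

/-- Composing a convex minorant of `gFun` with `T` gives another convex minorant. Monotonicity of
`gFun` thus passes to the envelope, in each direction in which points can be moved by an affine
self-map of the simplex. -/
theorem gEnv_comp_le {T : ℝ × ℝ → ℝ × ℝ} (hT : Set.MapsTo T simplexDomain simplexDomain)
    (haff : ∀ x y : ℝ × ℝ, ∀ a b : ℝ, a + b = 1 → T (a • x + b • y) = a • T x + b • T y)
    (hg : ∀ p ∈ simplexDomain, gFun (T p) ≤ gFun p) {p : ℝ × ℝ} (hp : p ∈ simplexDomain) :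
    gEnv (T p) ≤ gEnv p := by
  refine gEnv_le fun h hc hh => ?_
  refine le_gEnv (h := h ∘ T) ⟨convex_simplexDomain, ?_⟩
    (fun q hq => (hh _ (hT hq)).trans (hg q hq)) hp
  intro x hx y hy a b ha hb hab
  simp only [Function.comp, haff x y a b hab]
  exact hc.2 (hT hx) (hT hy) ha hb hab

/-- The envelope decreases in the second coordinate. -/
theorem gEnv_anti_snd {p : ℝ × ℝ} (hp : p ∈ simplexDomain) {y : ℝ} (hy : p.2 ≤ y)
    (hy1 : p.1 + y ≤ 1) : gEnv (p.1, y) ≤ gEnv p := by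
  obtain ⟨h1, h2, h3⟩ := hp
  rcases h3.eq_or_lt with h | h
  · have : (p.1, y) = p := Prod.ext rfl (by simp; linarith)
    rw [this]
  -- The affine map moves each point the fraction `s` of the way up to the hypotenuse; this `s`
  -- sends `p` to `(p.1, y)`.
  set s : ℝ := (y - p.2) / (1 - p.1 - p.2) with hs
  have hpos : 0 < 1 - p.1 - p.2 := by linarith
  have hs0 : 0 ≤ s := div_nonneg (by linarith) hpos.le
  have hs1 : s ≤ 1 := (div_le_one hpos).2 (by linarith)
  have hm : Set.MapsTo (fun x : ℝ × ℝ => (x.1, x.2 + s * (1 - x.1 - x.2))) simplexDomain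
      simplexDomain := by
    rintro x ⟨h1, h2, h3⟩
    exact ⟨h1, by simp only; nlinarith, by simp only; nlinarith⟩
  have key := gEnv_comp_le hm ?_ ?_ (p := p) ⟨h1, h2, h3⟩
  · have : p.2 + s * (1 - p.1 - p.2) = y := by rw [hs]; field_simp; ring
    simpa only [this] using key
  · intro x y a b hab
    obtain rfl : b = 1 - a := by linarith
    ext
    · simp
    · simp; ring
  · intro q hq
    exact gFun_mono hq (hm hq) le_rfl (by obtain ⟨h1, h2, h3⟩ := hq; simp only; nlinarith)

/-- The envelope decreases when mass moves from the first to the second coordinate. -/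
theorem gEnv_trade {p q : ℝ × ℝ} (hp : p ∈ simplexDomain) (hq : 0 ≤ q.1) (hqp : q.1 ≤ p.1)
    (hs : q.1 + q.2 = p.1 + p.2) : gEnv q ≤ gEnv p := by
  obtain ⟨h1, h2, h3⟩ := hp
  rcases h1.eq_or_lt with h | h
  · have : q = p := Prod.ext (by linarith) (by linarith)
    rw [this]
  set s : ℝ := q.1 / p.1 with hs'
  have hs0 : 0 ≤ s := div_nonneg hq h.le
  have hs1 : s ≤ 1 := (div_le_one h).2 hqp
  have hm : Set.MapsTo (fun x : ℝ × ℝ => (s * x.1, x.2 + (1 - s) * x.1)) simplexDomain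
      simplexDomain := by
    rintro x ⟨h1, h2, h3⟩
    exact ⟨by simp only; positivity, by simp only; nlinarith, by simp only; nlinarith⟩
  have key := gEnv_comp_le hm ?_ ?_ (p := p) ⟨h1, h2, h3⟩
  · have e1 : s * p.1 = q.1 := by rw [hs']; field_simp
    have e2 : p.2 + (1 - s) * p.1 = q.2 := by rw [sub_mul, e1]; linarith
    simpa only [e1, e2] using key
  · intro x y a b hab
    obtain rfl : b = 1 - a := by linarith
    ext
    · simp; ring
    · simp; ring
  · intro q hq
    refine gFun_mono hq (hm hq) ?_ ?_ <;> obtain ⟨h1, h2, h3⟩ := hq <;> simp only <;> nlinarith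

/-- The envelope increases in the first coordinate. -/
theorem gEnv_mono_fst {a b y : ℝ} (ha : 0 ≤ a) (hab : a ≤ b) (hy : 0 ≤ y) (hby : b + y ≤ 1) :
    gEnv (a, y) ≤ gEnv (b, y) := by
  have hb : ((b, y) : ℝ × ℝ) ∈ simplexDomain := ⟨by simp only; linarith, hy, hby⟩
  rcases ha.eq_or_lt with h | h
  · refine (gEnv_le_gFun ⟨ha, hy, by simp only; linarith⟩).trans ?_
    rw [← h, gFun_zero_left]
    exact le_gEnv_const hb
  have hb0 : 0 < b := by linarith
  refine gEnv_le fun k hc hk => ?_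
  -- On the edge `x₁ = 0` the function `gFun` takes its minimum `1 - 1/e`. Convexity of a minorant
  -- on the segment from `(0, y)` to `(b, y)` therefore bounds it by `gEnv (b, y)`.
  have h0 : ((0, y) : ℝ × ℝ) ∈ simplexDomain := ⟨le_rfl, hy, by simp only; linarith⟩
  have hs1 : a / b ≤ 1 := (div_le_one hb0).2 hab
  have := hc.2 hb h0 (div_nonneg ha hb0.le) (sub_nonneg.2 hs1) (by ring)
  have e : (a / b) • ((b, y) : ℝ × ℝ) + (1 - a / b) • ((0, y) : ℝ × ℝ) = (a, y) := by
    ext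
    · simp; field_simp
    · simp; ring
  rw [e] at this
  refine this.trans ?_
  have k0 := hk _ h0
  rw [gFun_zero_left] at k0
  have k1 := le_gEnv_const hb
  have k2 := le_gEnv hc hk hb
  have : 0 ≤ a / b := div_nonneg ha hb0.le
  simp only [smul_eq_mul]
  nlinarith

/-! ### The program that defines `zStar`. -/

theorem exp_neg_one_div_le_one (c : ℕ) : Real.exp (-1 / (c : ℝ)) ≤ 1 := by
  rw [Real.exp_le_one_iff, neg_div]
  have : (0 : ℝ) ≤ 1 / c := by positivity
  linarith

theorem feasible_point_mem {β σ z : ℝ} (hβ : β ≤ 1) (hσ : 1 ≤ σ) (hz : z ∈ Set.Icc (0 : ℝ) 1) :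
    ((max 0 (β - σ + z), z - max 0 (β - σ + z)) : ℝ × ℝ) ∈ simplexDomain := by
  have : max 0 (β - σ + z) ≤ z := max_le hz.1 (by linarith)
  exact ⟨le_max_left _ _, by simpa using this, by simpa using hz.2⟩

theorem one_mem_feasible {β σ : ℝ} (c : ℕ) (hβ : β ≤ 1) (hσ : 1 ≤ σ) : 1 ∈ feasible β c σ := by
  have hm := feasible_point_mem hβ hσ (z := 1) (by simp)
  have h1 := exp_neg_one_div_le_one c
  have h0 := (Real.exp_pos (-1 / (c : ℝ))).le
  have h2 := (gEnv_le_gFun hm).trans (gFun_le_one hm)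
  have h3 : (1 : ℝ) - 1 / Real.exp 1 ≤ 1 := by
    have := Real.exp_pos 1
    have : 0 ≤ 1 / Real.exp 1 := by positivity
    linarith
  exact ⟨by simp, by nlinarith, by nlinarith⟩

theorem mem_feasible_of_le {β σ z : ℝ} {c : ℕ} (hβ : β ≤ 1) (hσ : 1 ≤ σ)
    (hz : z ∈ Set.Icc (0 : ℝ) 1)
    (h : Real.exp (-1 / (c : ℝ)) * gEnv (max 0 (β - σ + z), z - max 0 (β - σ + z)) ≤ z) :
    z ∈ feasible β c σ := by
  refine ⟨hz, le_trans ?_ h, h⟩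
  have := le_gEnv_const (feasible_point_mem hβ hσ hz)
  gcongr

/-- Monotonicity replaces continuity in showing that the infimum of the feasible set is feasible.
Once the maximum is active, the second coordinate is frozen at `σ - β` and only the first one grows.
-/
theorem gEnv_feasible_mono {β σ z w : ℝ} (hβ : β ≤ 1) (hσ : 1 ≤ σ)
    (hz : z ∈ Set.Icc (0 : ℝ) 1) (hw : w ∈ Set.Icc (0 : ℝ) 1) (hzw : z ≤ w) :
    gEnv (max 0 (β - σ + z), z - max 0 (β - σ + z)) ≤
      gEnv (max 0 (β - σ + w), w - max 0 (β - σ + w)) := by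
  rcases le_total (β - σ + z) 0 with h | h
  · refine (gEnv_le_gFun (feasible_point_mem hβ hσ hz)).trans ?_
    rw [max_eq_left h, gFun_zero_left]
    exact le_gEnv_const (feasible_point_mem hβ hσ hw)
  · rw [max_eq_right h, max_eq_right (by linarith)]
    have e1 : z - (β - σ + z) = σ - β := by ring
    have e2 : w - (β - σ + w) = σ - β := by ring
    rw [e1, e2]
    exact gEnv_mono_fst h (by linarith) (by linarith) (by linarith [hw.2])

theorem zStar_isLeast {β σ : ℝ} (c : ℕ) (hβ : β ≤ 1) (hσ : 1 ≤ σ) :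
    IsLeast (feasible β c σ) (zStar β c σ) := by
  have hne : (feasible β c σ).Nonempty := ⟨1, one_mem_feasible c hβ hσ⟩
  have hbd : BddBelow (feasible β c σ) := ⟨0, fun z hz => hz.1.1⟩
  have hlow : ∀ z ∈ feasible β c σ, zStar β c σ ≤ z := fun z hz => csInf_le hbd hz
  refine ⟨?_, hlow⟩
  have hI : zStar β c σ ∈ Set.Icc (0 : ℝ) 1 :=
    ⟨le_csInf hne fun z hz => hz.1.1, hlow 1 (one_mem_feasible c hβ hσ)⟩
  refine mem_feasible_of_le hβ hσ hI (le_csInf hne fun z hz => le_trans ?_ hz.2.2)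
  exact mul_le_mul_of_nonneg_left (gEnv_feasible_mono hβ hσ hI hz.1 (hlow z hz))
    (Real.exp_pos _).le

/-! ### The inequality at a single opportunity. -/

/-- Pooling capacity into the fully valued part only lowers the compensation term. -/
theorem mul_psi_pool {x w y o : ℝ} (hw : 0 ≤ w) (ho : o ≤ 1)
    (hxwo : x + w ≤ o) (hsum : x + w + y ≤ 1) :
    (o - (x + w)) * psi (y / (1 - (x + w))) ≤ (o - x) * psi ((y + w) / (1 - x)) := by
  rcases (show x + w ≤ 1 by linarith).eq_or_lt with h | h
  · have : o = 1 := by linarith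
    have h0 : o - (x + w) = 0 := by linarith
    rw [h0, zero_mul]
    rcases (show x ≤ 1 by linarith).eq_or_lt with h' | h'
    · simp [this, h']
    · exact mul_nonneg (by linarith) (psi_nonneg ((div_le_one (by linarith)).2 (by linarith)))
  have hb : 0 < 1 - x := by linarith
  have hbw : 0 < 1 - (x + w) := by linarith
  -- The fill rate `(y + w) / (1 - x)` is a convex combination of `y / (1 - (x + w))` and `1`, and
  -- `psi 1 = 0`.
  have hc := convexOn_exp.2 (Set.mem_univ (y / (1 - (x + w)) - 1)) (Set.mem_univ 0)
    (div_nonneg hbw.le hb.le) (div_nonneg hw hb.le) (by field_simp; ring)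
  have e : ((1 - (x + w)) / (1 - x)) • (y / (1 - (x + w)) - 1) + (w / (1 - x)) • (0 : ℝ) =
      (y + w) / (1 - x) - 1 := by simp only [smul_eq_mul]; field_simp; ring
  rw [e] at hc
  simp only [smul_eq_mul, Real.exp_zero, mul_one] at hc
  set E := Real.exp (y / (1 - (x + w)) - 1) with hE
  have hE1 : E ≤ 1 := by
    rw [hE, Real.exp_le_one_iff, sub_nonpos]; exact (div_le_one hbw).2 (by linarith)
  have h1 : (1 - (x + w)) / (1 - x) * (1 - E) ≤ psi ((y + w) / (1 - x)) := by
    have : (1 - (x + w)) / (1 - x) + w / (1 - x) = 1 := by field_simp; ring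
    simp only [psi]; linarith
  calc (o - (x + w)) * psi (y / (1 - (x + w))) = (o - (x + w)) * (1 - E) := rfl
    _ ≤ ((o - x) * ((1 - (x + w)) / (1 - x))) * (1 - E) := by
        refine mul_le_mul_of_nonneg_right ?_ (by linarith)
        rw [← mul_div_assoc, le_div_iff₀ hb]
        nlinarith [mul_nonneg hw (sub_nonneg.2 ho)]
    _ = (o - x) * ((1 - (x + w)) / (1 - x) * (1 - E)) := by ring
    _ ≤ _ := mul_le_mul_of_nonneg_left h1 (by linarith)

/-- Both sides agree at `x = 0`. Comparing derivatives reduces to `e^{x/(1-u)} - e^x ≤ e^{x/(o-u)} -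
e^{x/o}`; writing each difference as a product, both factors on the right are the larger ones
because `o ≤ 1`. -/
theorem exp_comparison {u o x : ℝ} (hu : 0 ≤ u) (huo : u < o) (ho : o ≤ 1) (hx : 0 ≤ x) :
    o * (Real.exp (x / o) - 1) + (o - u) * Real.exp (x / (1 - u)) ≤
      Real.exp x - 1 + (o - u) * Real.exp (x / (o - u)) := by
  have ha : 0 < o - u := by linarith
  have hb : 0 < 1 - u := by linarith
  have ho0 : 0 < o := by linarith
  set F : ℝ → ℝ := fun x => (o - u) * Real.exp (x * (1 / (o - u))) -
    (o - u) * Real.exp (x * (1 / (1 - u))) - o * Real.exp (x * (1 / o)) + Real.exp x with hF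
  have hd : ∀ y c : ℝ, HasDerivAt (fun x => Real.exp (x * c)) (Real.exp (y * c) * c) y := by
    intro y c
    simpa using ((hasDerivAt_id y).mul_const c).exp
  have hD : ∀ y, HasDerivAt F ((o - u) * (Real.exp (y * (1 / (o - u))) * (1 / (o - u))) -
      (o - u) * (Real.exp (y * (1 / (1 - u))) * (1 / (1 - u))) -
      o * (Real.exp (y * (1 / o)) * (1 / o)) + Real.exp y) y := fun y =>
    ((((hd y _).const_mul _).sub ((hd y _).const_mul _)).sub ((hd y _).const_mul _)).add
      (Real.hasDerivAt_exp y)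
  have hmono : MonotoneOn F (Set.Ici 0) := by
    refine monotoneOn_of_deriv_nonneg (convex_Ici 0)
      (fun y _ => (hD y).continuousAt.continuousWithinAt)
      (fun y _ => (hD y).differentiableAt.differentiableWithinAt) ?_
    intro y hy
    rw [interior_Ici] at hy
    have hy0 : 0 ≤ y := le_of_lt hy
    rw [(hD y).deriv]
    have e1 : (o - u) * (Real.exp (y * (1 / (o - u))) * (1 / (o - u))) =
      Real.exp (y * (1 / (o - u))) := by field_simp
    have e2 : o * (Real.exp (y * (1 / o)) * (1 / o)) = Real.exp (y * (1 / o)) := by field_simp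
    have h3 : (o - u) * (Real.exp (y * (1 / (1 - u))) * (1 / (1 - u))) ≤
        Real.exp (y * (1 / (1 - u))) := by
      have : (o - u) * (1 / (1 - u)) ≤ 1 := by
        rw [mul_one_div, div_le_one hb]; linarith
      nlinarith [Real.exp_pos (y * (1 / (1 - u)))]
    rw [e1, e2]
    have f1 : Real.exp (y * (1 / (o - u))) =
        Real.exp (y * (1 / o)) * Real.exp (y * (1 / (o - u) - 1 / o)) := by
      rw [← Real.exp_add]; ring_nf
    have f2 : Real.exp (y * (1 / (1 - u))) =
        Real.exp y * Real.exp (y * (1 / (1 - u) - 1)) := by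
      rw [← Real.exp_add]; ring_nf
    have g1 : Real.exp y ≤ Real.exp (y * (1 / o)) := by
      apply Real.exp_le_exp.2
      rw [mul_one_div, le_div_iff₀ ho0]; nlinarith
    have g2 : 1 / (1 - u) - 1 ≤ 1 / (o - u) - 1 / o := by
      have r1 : 1 / (1 - u) - 1 = u / (1 - u) := by field_simp; ring
      have r2 : 1 / (o - u) - 1 / o = u / ((o - u) * o) := by field_simp; ring
      rw [r1, r2]
      gcongr
      nlinarith
    have g3 : Real.exp (y * (1 / (1 - u) - 1)) ≤ Real.exp (y * (1 / (o - u) - 1 / o)) := by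
      gcongr
    have g4 : 1 ≤ Real.exp (y * (1 / (1 - u) - 1)) := by
      rw [Real.one_le_exp_iff]
      refine mul_nonneg hy0 ?_
      rw [sub_nonneg, le_div_iff₀ hb]; linarith
    have := mul_le_mul g1 (sub_le_sub_right g3 1) (by linarith) (Real.exp_pos _).le
    rw [f1]
    linarith [h3.trans_eq f2]
  have := hmono (Set.mem_Ici.2 le_rfl) (Set.mem_Ici.2 hx) hx
  simp only [hF, mul_one_div, zero_div, Real.exp_zero] at this
  linarith

/-- A function of the form `exp x - a exp (x / b)` is at least the smaller of its endpoint
values. -/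
theorem exp_sub_ge_min {a b x L M m : ℝ} (ha : 0 ≤ a) (hb : 0 < b) (hb1 : b ≤ 1) (hL : L ≤ x)
    (hM : x ≤ M) (h1 : m ≤ Real.exp L - a * Real.exp (L / b))
    (h2 : m ≤ Real.exp M - a * Real.exp (M / b)) : m ≤ Real.exp x - a * Real.exp (x / b) := by
  have hp : ∀ y, Real.exp (y / b) = Real.exp y ^ (1 / b) := by
    intro y; rw [← Real.exp_mul]; ring_nf
  rw [hp] at h1 h2 ⊢
  -- In the variable `v = exp x` the function is `v - a * v ^ (1 / b)`, concave because `1 / b ≥ 1`.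
  have hcv : ConcaveOn ℝ (Set.Ici (0 : ℝ)) fun v : ℝ => v - a * v ^ (1 / b) := by
    refine (concaveOn_id (convex_Ici 0)).sub ?_
    exact (convexOn_rpow ((one_le_div hb).2 hb1)).smul ha
  have hmem : Real.exp x ∈ segment ℝ (Real.exp L) (Real.exp M) := by
    rw [segment_eq_Icc (Real.exp_le_exp.2 (hL.trans hM))]
    exact ⟨Real.exp_le_exp.2 hL, Real.exp_le_exp.2 hM⟩
  have := hcv.ge_on_segment (Set.mem_Ici.2 (Real.exp_pos L).le)
    (Set.mem_Ici.2 (Real.exp_pos M).le) hmem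
  exact (le_min h1 h2).trans this

/-- This settles the extreme case in `exists_gFun_le`, in which the opportunity is filled to
capacity (`y = 1 - u`) although its optimal fill is only `o`. -/
theorem mul_exp_one_sub_le {u o : ℝ} (hu : 0 ≤ u) (huo : u ≤ o) (ho0 : 0 < o) (ho : o ≤ 1) :
    o * (Real.exp (1 - u / o) - 1) ≤ Real.exp (1 - u) - 1 := by
  have h1 : Real.exp (1 - u) = Real.exp (1 - u / o) * Real.exp (u / o - u) := by
    rw [← Real.exp_add]; ring_nf
  have h2 := Real.add_one_le_exp (u / o - u)
  have h3 : 1 ≤ Real.exp (1 - u / o) := by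
    rw [Real.one_le_exp_iff, sub_nonneg]; exact (div_le_one ho0).2 huo
  have h4 : 0 ≤ u / o := by positivity
  have h5 : u / o - u = (u / o) * (1 - o) := by field_simp
  have h6 : 0 ≤ (1 - o) * (u / o) := mul_nonneg (by linarith) h4
  rw [h1]
  nlinarith [mul_nonneg (sub_nonneg.2 h3) h6, mul_nonneg (sub_nonneg.2 h3) (sub_nonneg.2 ho),
    mul_le_mul_of_nonneg_left h2 (zero_le_one.trans h3)]

/-- The value collected at an opportunity whose optimal fill is `o` dominates the trade-off
function at a point of the simplex. -/
theorem exists_gFun_le {x w y o : ℝ} (hx : 0 ≤ x) (hw : 0 ≤ w) (hy : 0 ≤ y) (hxo : x ≤ o)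
    (ho0 : 0 < o) (ho : o ≤ 1) (hsum : x + w + y ≤ 1) :
    ∃ P ∈ simplexDomain, ∃ ex : ℝ, 0 ≤ ex ∧ ex ≤ x + w ∧
      o * (P.1 + P.2) ≤ x + w + y - ex ∧ x + w - ex ≤ o * P.1 ∧
      o * gFun P ≤ x + w - ex + (Real.exp (y - 1) - Real.exp (-1)) +
        (o - x) * psi ((y + w) / (1 - x)) := by
  have hψ : 0 ≤ (o - x) * psi ((y + w) / (1 - x)) := by
    refine mul_nonneg (by linarith) (psi_nonneg ?_)
    rcases (show x ≤ 1 by linarith).eq_or_lt with h | h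
    · simp [h]
    · exact (div_le_one (by linarith)).2 (by linarith)
  have hk : 0 ≤ Real.exp (y - 1) - Real.exp (-1) := by
    rw [sub_nonneg]; exact Real.exp_le_exp.2 (by linarith)
  -- Capacity is normalized to one; `x` is external, `w` unweighted internal and `y` weighted
  -- internal fill. If `x + w` already reaches `o`, the vertex `(1, 0)` serves and the surplus is
  -- discarded.
  rcases le_or_gt o (x + w) with h | h
  · refine ⟨(1, 0), ⟨by norm_num, le_rfl, by norm_num⟩, x + w - o, by linarith, by linarith,
      by simp only; linarith, by simp only; linarith, ?_⟩
    rw [gFun_one_zero]; linarith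
  have hpool := mul_psi_pool hw ho h.le hsum
  obtain ⟨u, hu⟩ : ∃ u, u = x + w := ⟨_, rfl⟩
  rw [← hu] at hpool hsum h ⊢
  have hu0 : 0 ≤ u := by linarith
  have ha : 0 < o - u := by linarith
  have hb : 0 < 1 - u := by linarith
  have em : ∀ z : ℝ, Real.exp (z - 1) = Real.exp (-1) * Real.exp z := by
    intro z; rw [← Real.exp_add]; ring_nf
  have ee : Real.exp (-1) * Real.exp 1 = 1 := by rw [← Real.exp_add]; simp
  -- The conditions encode `v = min y (o - u)`, the weighted fill that still fits under `o`. When it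
  -- is truncated, the inequality in `y` is checked only at the ends `o - u` and `1 - u` and
  -- extended by `exp_sub_ge_min`.
  have main : ∀ v, 0 ≤ v → u + v ≤ o → (u + v < o → v = y) → v ≤ y →
      o * (Real.exp (v / o) - 1) + (o - u) * (Real.exp (y / (1 - u))) ≤
        Real.exp y - 1 + (o - u) * Real.exp (v / (o - u)) := by
    intro v hv huv hvy hvy'
    rcases huv.eq_or_lt with h' | h'
    · have hv' : v = o - u := by linarith
      have hE := exp_comparison hu0 h ho hv
      have := exp_sub_ge_min (a := o - u) (b := 1 - u) (L := v) (M := 1 - u) (x := y)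
        (m := o * (Real.exp (v / o) - 1) + 1 - (o - u) * Real.exp (v / (o - u)))
        ha.le hb (by linarith) hvy' (by linarith) (by linarith) ?_
      · linarith
      · have h5 := mul_exp_one_sub_le hu0 h.le ho0 ho
        have e1 : v / o = 1 - u / o := by rw [hv']; field_simp
        rw [e1, hv', div_self ha.ne', div_self hb.ne']
        linarith
    · rw [hvy h']; exact exp_comparison hu0 h ho hy
  have fin : ∀ v, 0 ≤ v → u + v ≤ o → (u + v < o → v = y) → v ≤ y →
      ∃ P ∈ simplexDomain, ∃ ex : ℝ, 0 ≤ ex ∧ ex ≤ u ∧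
      o * (P.1 + P.2) ≤ u + y - ex ∧ u - ex ≤ o * P.1 ∧
      o * gFun P ≤ u - ex + (Real.exp (y - 1) - Real.exp (-1)) +
        (o - x) * psi ((y + w) / (1 - x)) := by
    intro v hv huv hvy hvy'
    have e1 : o * (u / o) = u := by field_simp
    have e2 : o * (v / o) = v := by field_simp
    refine ⟨(u / o, v / o), ⟨by simp only; positivity, by simp only; positivity, ?_⟩, 0, le_rfl,
      hu0, by simp only; linarith, by simp only; linarith, ?_⟩
    · simp only; rw [← add_div]; exact (div_le_one ho0).2 huv
    refine le_trans ?_ (add_le_add_right hpool _)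
    have hm := mul_le_mul_of_nonneg_left (main v hv huv hvy hvy') (Real.exp_pos (-1)).le
    rw [gFun_eq]
    have e3 : v / o / (1 - u / o) = v / (o - u) := by field_simp
    have e4 : o * ((1 - u / o) * Real.exp (v / (o - u) - 1)) =
        (o - u) * Real.exp (v / (o - u) - 1) := by
      field_simp
    simp only [psi, e3]
    have e5 : ∀ A B C : ℝ, o * (A + B - C) = o * A + o * B - o * C := by intros; ring
    rw [e5, e4, em, em, em, em]
    nlinarith
  rcases le_or_gt (u + y) o with h' | h'
  · exact fin y hy h' (fun _ => rfl) le_rfl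
  · exact fin (o - u) ha.le (by linarith) (fun h => by linarith) (by linarith)

/-- Each (fractional) unit of fill increases the exponential potential by at most
the discounted reward. -/
theorem exp_step {C j a Y : ℝ} (hC : 0 < C) (haj : a ≤ j) (hY0 : 0 ≤ Y) (hY : Y ≤ 1) :
    Real.exp (-1 / C) * (C * (Real.exp ((a + Y) / C - 1) - Real.exp (a / C - 1))) ≤
      Y * Real.exp (j / C - 1) := by
  have h1 : Real.exp ((a + Y) / C - 1) = Real.exp (a / C - 1) * Real.exp (Y / C) := by
    rw [← Real.exp_add]; ring_nf
  have h2 : Real.exp (a / C - 1) ≤ Real.exp (j / C - 1) := by gcongr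
  -- The potential is charged at the start of a jump of size `Y ≤ 1`, which loses at most the factor
  -- `exp (Y / C) ≤ exp (1 / C)`.
  have h3 : Real.exp (-1 / C) * (C * (Real.exp (Y / C) - 1)) ≤ Y := by
    have i1 : 1 - Y / C ≤ Real.exp (-(Y / C)) := by linarith [Real.add_one_le_exp (-(Y / C))]
    have i2 : Real.exp (Y / C) * Real.exp (-(Y / C)) = 1 := by rw [← Real.exp_add]; simp
    have i3 : Real.exp (Y / C) - 1 ≤ Real.exp (Y / C) * (Y / C) := by
      nlinarith [Real.exp_pos (Y / C)]
    have i4 : C * (Real.exp (Y / C) - 1) ≤ Y * Real.exp (Y / C) := by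
      calc _ ≤ C * (Real.exp (Y / C) * (Y / C)) := by gcongr
        _ = _ := by field_simp
    have i5 : Real.exp (-1 / C) * Real.exp (Y / C) ≤ 1 := by
      rw [← Real.exp_add, Real.exp_le_one_iff, ← add_div]
      exact div_nonpos_of_nonpos_of_nonneg (by linarith) hC.le
    calc _ ≤ Real.exp (-1 / C) * (Y * Real.exp (Y / C)) := by gcongr
      _ = Y * (Real.exp (-1 / C) * Real.exp (Y / C)) := by ring
      _ ≤ Y * 1 := by gcongr
      _ = Y := mul_one Y
  rw [h1]
  calc _ = (Real.exp (-1 / C) * (C * (Real.exp (Y / C) - 1))) * Real.exp (a / C - 1) := by ring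
    _ ≤ Y * Real.exp (a / C - 1) := by gcongr
    _ ≤ _ := by gcongr

/-! ### Expectation over sample paths and independence. -/

namespace Problem

variable (I : Problem)

theorem prob_nonneg (ω : I.Path) : 0 ≤ I.prob ω := by
  refine Finset.prod_nonneg fun t _ => Finset.prod_nonneg fun i _ => ?_
  have := (I.vol t).μ_mem i
  split_ifs
  · exact this.1
  · linarith [this.2]

theorem sum_prob : ∑ ω, I.prob ω = 1 := by
  have h : ∀ t, ∑ w : Fin I.n → Bool,
      ∏ i, (if w i then (I.vol t).μ i else 1 - (I.vol t).μ i) = 1 := by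
    intro t
    have := Finset.prod_univ_sum (fun _ : Fin I.n => (Finset.univ : Finset Bool))
      (fun i b => if b then (I.vol t).μ i else 1 - (I.vol t).μ i)
    rw [Fintype.piFinset_univ] at this
    rw [← this]
    simp
  have := Finset.prod_univ_sum (fun _ : Fin I.T => (Finset.univ : Finset (Fin I.n → Bool)))
    (fun t w => ∏ i, (if w i then (I.vol t).μ i else 1 - (I.vol t).μ i))
  rw [Fintype.piFinset_univ] at this
  simp only [prob]
  rw [← this]
  simp [h]

variable {I}

theorem expect_mono {f g : I.Path → ℝ} (h : ∀ ω, f ω ≤ g ω) : I.expect f ≤ I.expect g :=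
  Finset.sum_le_sum fun ω _ => mul_le_mul_of_nonneg_left (h ω) (I.prob_nonneg ω)

theorem expect_const (a : ℝ) : I.expect (fun _ => a) = a := by
  simp only [expect, ← Finset.sum_mul, sum_prob, one_mul]

theorem expect_add (f g : I.Path → ℝ) :
    I.expect (fun ω => f ω + g ω) = I.expect f + I.expect g := by
  simp only [expect, mul_add, Finset.sum_add_distrib]

theorem expect_sub (f g : I.Path → ℝ) :
    I.expect (fun ω => f ω - g ω) = I.expect f - I.expect g := by
  simp only [expect, mul_sub, Finset.sum_sub_distrib]

theorem expect_mul_left (a : ℝ) (f : I.Path → ℝ) :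
    I.expect (fun ω => a * f ω) = a * I.expect f := by
  simp only [expect, Finset.mul_sum]
  exact Finset.sum_congr rfl fun _ _ => by ring

theorem expect_sum {ι : Type*} (s : Finset ι) (f : ι → I.Path → ℝ) :
    I.expect (fun ω => ∑ i ∈ s, f i ω) = ∑ i ∈ s, I.expect (f i) := by
  simp only [expect, Finset.mul_sum]
  exact Finset.sum_comm

theorem expect_nonneg {f : I.Path → ℝ} (h : ∀ ω, 0 ≤ f ω) : 0 ≤ I.expect f :=
  Finset.sum_nonneg fun ω _ => mul_nonneg (I.prob_nonneg ω) (h ω)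

theorem expect_min_le (a : ℝ) (f : I.Path → ℝ) :
    I.expect (fun ω => min a (f ω)) ≤ min a (I.expect f) :=
  le_min ((expect_mono fun _ => min_le_left _ _).trans_eq (expect_const a))
    (expect_mono fun _ => min_le_right _ _)

/-- The path in which the realization of the pair `(t, i)` is negated. -/
def flip (t : Fin I.T) (i : Fin I.n) (ω : I.Path) : I.Path :=
  Function.update ω t (Function.update (ω t) i (!ω t i))

theorem flip_flip (t : Fin I.T) (i : Fin I.n) (ω : I.Path) : flip t i (flip t i ω) = ω := by
  simp [flip]

theorem flip_apply_self (t : Fin I.T) (i : Fin I.n) (ω : I.Path) :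
    flip t i ω t i = !ω t i := by simp [flip]

theorem flip_apply_of_ne {t s : Fin I.T} (i : Fin I.n) (ω : I.Path) (h : s ≠ t) :
    flip t i ω s = ω s := by simp [flip, h]

theorem prob_eq_mul (t : Fin I.T) (i : Fin I.n) :
    ∃ R : I.Path → ℝ, (∀ ω, R (flip t i ω) = R ω) ∧
      ∀ ω, I.prob ω = (if ω t i then (I.vol t).μ i else 1 - (I.vol t).μ i) * R ω := by
  refine ⟨fun ω => (∏ j ∈ Finset.univ.erase i,
      if ω t j then (I.vol t).μ j else 1 - (I.vol t).μ j) *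
      ∏ s ∈ Finset.univ.erase t, ∏ j, if ω s j then (I.vol s).μ j else 1 - (I.vol s).μ j, ?_, ?_⟩
  · intro ω
    beta_reduce
    congr 1
    · refine Finset.prod_congr rfl fun j hj => ?_
      have : flip t i ω t j = ω t j := by simp [flip, (Finset.mem_erase.1 hj).1]
      rw [this]
    · refine Finset.prod_congr rfl fun s hs => ?_
      rw [flip_apply_of_ne i ω (Finset.mem_erase.1 hs).1]
  · intro ω
    have h1 := Finset.mul_prod_erase Finset.univ
      (fun j => if ω t j then (I.vol t).μ j else 1 - (I.vol t).μ j) (Finset.mem_univ i)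
    have h2 := Finset.mul_prod_erase Finset.univ
      (fun s => ∏ j, if ω s j then (I.vol s).μ j else 1 - (I.vol s).μ j) (Finset.mem_univ t)
    rw [prob, ← h2, ← h1, mul_assoc]

/-- A realization is independent of every quantity that does not depend on it. -/
theorem expect_mul_indicator (t : Fin I.T) (i : Fin I.n) (F : I.Path → ℝ)
    (hF : ∀ ω, F (flip t i ω) = F ω) :
    I.expect (fun ω => F ω * if ω t i then 1 else 0) = (I.vol t).μ i * I.expect F := by
  obtain ⟨R, hR, hp⟩ := prob_eq_mul t i
  have hflip : ∑ ω, R ω * F ω * (if ω t i then (0 : ℝ) else 1) =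
      ∑ ω, R ω * F ω * (if ω t i then (1 : ℝ) else 0) := by
    refine Finset.sum_bij' (fun ω _ => flip t i ω) (fun ω _ => flip t i ω) (by simp) (by simp)
      (fun ω _ => flip_flip t i ω) (fun ω _ => flip_flip t i ω) ?_
    intro ω _
    rw [hR, hF, flip_apply_self]
    cases ω t i <;> simp
  set B := ∑ ω, R ω * F ω * (if ω t i then (1 : ℝ) else 0) with hB
  have h1 : I.expect (fun ω => F ω * if ω t i then 1 else 0) = (I.vol t).μ i * B := by
    simp only [expect, hB, Finset.mul_sum]
    refine Finset.sum_congr rfl fun ω _ => ?_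
    rw [hp]
    cases ω t i <;> simp
    ring
  have h2 : I.expect F = (I.vol t).μ i * B + (1 - (I.vol t).μ i) * B := by
    conv_rhs => arg 2; rw [← hflip]
    simp only [expect, hB, Finset.mul_sum, ← Finset.sum_add_distrib]
    refine Finset.sum_congr rfl fun ω _ => ?_
    rw [hp]
    cases ω t i <;> simp <;> ring
  rw [h1, h2]; ring

/-- The sum of the terms of `a` before time `t`. -/
def partialSum (a : Fin I.T → ℝ) (t : ℕ) : ℝ :=
  ∑ s ∈ Finset.range t, if h : s < I.T then a ⟨s, h⟩ else 0

theorem partialSum_zero (a : Fin I.T → ℝ) : partialSum a 0 = 0 := by simp [partialSum]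

theorem partialSum_succ (a : Fin I.T → ℝ) {t : ℕ} (h : t < I.T) :
    partialSum a (t + 1) = partialSum a t + a ⟨t, h⟩ := by
  simp [partialSum, Finset.sum_range_succ, h]

theorem partialSum_T (a : Fin I.T → ℝ) : partialSum a I.T = ∑ t, a t := by
  rw [partialSum, Finset.sum_range]
  exact Finset.sum_congr rfl fun t _ => by simp

/-- Induction along the horizon. -/
theorem horizon_induction {P : ℕ → Prop} (h0 : P 0)
    (hs : ∀ t (_ : t < I.T), P t → P (t + 1)) : ∀ t ≤ I.T, P t := by
  intro t
  induction t with
  | zero => exact fun _ => h0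
  | succ t ih => exact fun h => hs t (by omega) (ih (by omega))

/-! ### Recommendations and sign-ups along a history. -/

/-- The indicator that policy `π` recommends `i` to the internal volunteer `t`. -/
def recommends (π : Policy I.n) (ω : I.Path) (t : Fin I.T) (i : Fin I.n) : ℝ :=
  if (I.vol t).target = none ∧ π (I.history π ω t) (I.vol t) = some i then 1 else 0

/-- The indicator that the internal volunteer `t` signs up for `i` under policy `π`. -/
def signup (π : Policy I.n) (ω : I.Path) (t : Fin I.T) (i : Fin I.n) : ℝ :=
  recommends π ω t i * if ω t i then 1 else 0

/-- The indicator that volunteer `t` is external and targets `i`. -/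
def targets (t : Fin I.T) (i : Fin I.n) : ℝ := if (I.vol t).target = some i then 1 else 0

theorem sum_targets (i : Fin I.n) : ∑ t, targets t i = (I.external i : ℝ) := by
  simp [targets, external]

theorem history_succ (π : Policy I.n) (ω : I.Path) {t : ℕ} (h : t < I.T) :
    I.history π ω (t + 1) = (I.vol ⟨t, h⟩,
      decision (I.vol ⟨t, h⟩) (ω ⟨t, h⟩) (π (I.history π ω t) (I.vol ⟨t, h⟩))) ::
        I.history π ω t := by
  rw [history, dif_pos h]

theorem history_congr (π : Policy I.n) {ω ω' : I.Path} (t : ℕ) (ht : t ≤ I.T)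
    (h : ∀ s : Fin I.T, s.val < t → ω s = ω' s) : I.history π ω t = I.history π ω' t := by
  induction t with
  | zero => rfl
  | succ t ih =>
    have ht' : t < I.T := ht
    rw [history_succ π ω ht', history_succ π ω' ht',
      ih ht'.le fun s hs => h s (by omega), h ⟨t, ht'⟩ (by simp)]

theorem history_flip (π : Policy I.n) (ω : I.Path) (t : Fin I.T) (i : Fin I.n) :
    I.history π (flip t i ω) t = I.history π ω t :=
  history_congr π t t.2.le fun s hs => flip_apply_of_ne i ω (by rintro rfl; omega)

theorem recommends_flip (π : Policy I.n) (ω : I.Path) (t : Fin I.T) (i j : Fin I.n) :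
    recommends π (flip t i ω) t j = recommends π ω t j := by
  simp only [recommends, history_flip]

/-- The recommendation and the history at time `t` depend only on earlier realizations, so the
realization at `(t, i)` is independent of them. -/
theorem expect_signup_mul (π : Policy I.n) (t : Fin I.T) (i : Fin I.n) (F : History I.n → ℝ) :
    I.expect (fun ω => signup π ω t i * F (I.history π ω t)) =
      (I.vol t).μ i * I.expect (fun ω => recommends π ω t i * F (I.history π ω t)) := by
  rw [← expect_mul_indicator]
  · congr 1; ext ω; simp only [signup]; ring
  · intro ω; rw [recommends_flip, history_flip]

theorem expect_signup (π : Policy I.n) (t : Fin I.T) (i : Fin I.n) :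
    I.expect (fun ω => signup π ω t i) = (I.vol t).μ i * I.expect (fun ω => recommends π ω t i) := by
  simpa using expect_signup_mul π t i fun _ => 1

theorem recommends_nonneg (π : Policy I.n) (ω : I.Path) (t : Fin I.T) (i : Fin I.n) :
    0 ≤ recommends π ω t i := by
  rw [recommends]; split_ifs <;> norm_num

theorem signup_nonneg (π : Policy I.n) (ω : I.Path) (t : Fin I.T) (i : Fin I.n) :
    0 ≤ signup π ω t i :=
  mul_nonneg (recommends_nonneg π ω t i) (by split_ifs <;> norm_num)

theorem sum_recommends_mul_le (π : Policy I.n) (ω : I.Path) (t : Fin I.T) (f : Fin I.n → ℝ) {B : ℝ}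
    (hB : 0 ≤ B) (hf : ∀ i, f i ≤ B) : ∑ i, recommends π ω t i * f i ≤ B := by
  simp only [recommends]
  by_cases h : (I.vol t).target = none
  · cases h' : π (I.history π ω t) (I.vol t) with
    | none => simpa using hB
    | some j => simpa [h] using hf j
  · simpa [h] using hB

theorem decision_indicator (π : Policy I.n) (ω : I.Path) (t : Fin I.T) (i : Fin I.n) :
    (if decision (I.vol t) (ω t) (π (I.history π ω t) (I.vol t)) = some i then (1 : ℝ) else 0) =
      targets t i + signup π ω t i := by
  simp only [targets, signup, recommends]
  generalize π (I.history π ω t) (I.vol t) = r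
  generalize I.vol t = v
  obtain ⟨_ | j, μ, h1, h2⟩ := v
  · cases r with
    | none => simp [decision]
    | some j =>
      by_cases hj : j = i
      · subst hj; by_cases hw : ω t j <;> simp [decision, hw]
      · by_cases hw : ω t j <;> simp [decision, hw, hj]
  · simp [decision]

theorem count_history (π : Policy I.n) (ω : I.Path) (i : Fin I.n) :
    ∀ t ≤ I.T, (((I.history π ω t).map Prod.snd).count (some i) : ℝ) =
      partialSum (fun t => targets t i + signup π ω t i) t := by
  refine horizon_induction ?_ ?_
  · simp [history, partialSum_zero]
  · intro t ht ih
    rw [history_succ π ω ht, partialSum_succ _ ht, ← ih, ← decision_indicator]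
    simp [List.count_cons]

theorem signups_eq (π : Policy I.n) (ω : I.Path) (i : Fin I.n) :
    (I.signups π ω i : ℝ) = I.external i + ∑ t, signup π ω t i := by
  rw [signups, count_history π ω i _ le_rfl, partialSum_T, Finset.sum_add_distrib, sum_targets]

theorem value_le (π : Policy I.n) :
    I.value π ≤ ∑ i, min (I.cap i : ℝ)
      (I.external i + ∑ t, (I.vol t).μ i * I.expect fun ω => recommends π ω t i) := by
  rw [value, expect_sum]
  refine Finset.sum_le_sum fun i _ => (expect_min_le _ _).trans (le_of_eq ?_)
  congr 1
  simp only [signups_eq]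
  rw [expect_add, expect_const, expect_sum]
  simp only [expect_signup]

/-- Every policy is dominated by a fractional assignment of internal traffic to the capacity that
external traffic leaves over. -/
theorem exists_fractional (π : Policy I.n) : ∃ y : Fin I.T → Fin I.n → ℝ,
    (∀ t i, 0 ≤ y t i) ∧ (∀ t, ∑ i, y t i ≤ 1) ∧
    (∀ t i, y t i ≠ 0 → (I.vol t).target = none ∧ 0 < (I.vol t).μ i) ∧
    (∀ i, min (I.cap i : ℝ) (I.external i) + ∑ t, (I.vol t).μ i * y t i ≤ I.cap i) ∧
    I.value π ≤ ∑ i, (min (I.cap i : ℝ) (I.external i) + ∑ t, (I.vol t).μ i * y t i) := by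
  set p : Fin I.T → Fin I.n → ℝ := fun t i => I.expect fun ω => recommends π ω t i with hp
  have hp0 : ∀ t i, 0 ≤ p t i := fun t i => expect_nonneg fun ω => recommends_nonneg π ω t i
  set w : Fin I.n → ℝ := fun i => ∑ t, (I.vol t).μ i * p t i with hw
  have hw0 : ∀ i, 0 ≤ w i := fun i => Finset.sum_nonneg fun t _ =>
    mul_nonneg ((I.vol t).μ_mem i).1 (hp0 t i)
  set e : Fin I.n → ℝ := fun i => min (I.cap i : ℝ) (I.external i) with he
  set o : Fin I.n → ℝ := fun i => min (I.cap i : ℝ) (I.external i + w i) with ho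
  have heo : ∀ i, e i ≤ o i := fun i => min_le_min_left _ (by linarith [hw0 i])
  have hoe : ∀ i, o i - e i ≤ w i := by
    intro i
    simp only [ho, he]
    rcases le_total (I.cap i : ℝ) (I.external i) with h | h
    · rw [min_eq_left h]; linarith [min_le_left (I.cap i : ℝ) (I.external i + w i), hw0 i]
    · rw [min_eq_right h]; linarith [min_le_right (I.cap i : ℝ) (I.external i + w i)]
  -- Scaling the recommendation probabilities by `s i` trims the expected internal fill from `w i`
  -- to `o i - e i`. If `w i = 0`, then `o i = e i` and the default value `s i = 0` is right.
  set s : Fin I.n → ℝ := fun i => (o i - e i) / w i with hs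
  have hs0 : ∀ i, 0 ≤ s i := fun i => div_nonneg (sub_nonneg.2 (heo i)) (hw0 i)
  have hs1 : ∀ i, s i ≤ 1 := fun i => div_le_one_of_le₀ (hoe i) (hw0 i)
  have hsw : ∀ i, s i * w i = o i - e i := by
    intro i
    rcases (hw0 i).eq_or_lt with h | h
    · have h1 := hoe i; have h2 := heo i
      rw [← h] at h1 ⊢; linarith
    · simp only [hs]; field_simp
  set y : Fin I.T → Fin I.n → ℝ := fun t i => if 0 < (I.vol t).μ i then s i * p t i else 0
    with hy
  have hyμ : ∀ i, ∑ t, (I.vol t).μ i * y t i = o i - e i := by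
    intro i
    rw [← hsw, hw, Finset.mul_sum]
    refine Finset.sum_congr rfl fun t _ => ?_
    simp only [hy]
    split_ifs with h
    · ring
    · have : (I.vol t).μ i = 0 := le_antisymm (not_lt.1 h) ((I.vol t).μ_mem i).1
      simp [this]
  refine ⟨y, ?_, ?_, ?_, ?_, ?_⟩
  · intro t i; simp only [hy]; split_ifs
    · exact mul_nonneg (hs0 i) (hp0 t i)
    · exact le_rfl
  · intro t
    calc ∑ i, y t i ≤ ∑ i, p t i := by
          refine Finset.sum_le_sum fun i _ => ?_
          simp only [hy]; split_ifs
          · exact mul_le_of_le_one_left (hp0 t i) (hs1 i)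
          · exact hp0 t i
      _ = I.expect fun ω => ∑ i, recommends π ω t i := (expect_sum _ _).symm
      _ ≤ I.expect fun _ => 1 := expect_mono fun ω => by
          simpa using sum_recommends_mul_le π ω t (fun _ => 1) zero_le_one fun _ => le_rfl
      _ = 1 := expect_const 1
  · intro t i h
    by_cases hμ : 0 < (I.vol t).μ i
    · refine ⟨?_, hμ⟩
      by_contra hn
      apply h
      simp [hy, hp, recommends, hn, expect_const]
    · simp [hy, hμ] at h
  · intro i
    rw [hyμ]
    linarith [min_le_left (I.cap i : ℝ) (I.external i + w i)]
  · refine (value_le π).trans (Finset.sum_le_sum fun i _ => ?_)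
    rw [hyμ]
    change o i ≤ e i + (o i - e i)
    linarith

end Problem

/-! ### Counters, fill rates and the greedy choice. -/

section Counters

variable {n : ℕ} (cap : Fin n → ℕ)

theorem counters_cons (a : Volunteer n × Option (Fin n)) (H : History n) :
    counters cap (a :: H) = Counters.update cap a (counters cap H) := rfl

theorem counters_add (H : History n) (i : Fin n) :
    (counters cap H).ext i + (counters cap H).int i =
      min (cap i) ((H.map Prod.snd).count (some i)) := by
  induction H with
  | nil => simp [counters]
  | cons a H ih =>
    rw [counters_cons, List.map_cons, List.count_cons]
    simp only [Counters.update, beq_iff_eq]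
    split <;> simp only <;> split_ifs <;> omega

theorem counters_add_le (H : History n) (i : Fin n) :
    (counters cap H).ext i + (counters cap H).int i ≤ cap i :=
  (counters_add cap H i).trans_le (min_le_left _ _)

variable {cap}

theorem fillRate_le_one {s : Counters n} {i : Fin n} (h : s.ext i + s.int i ≤ cap i) :
    fillRate cap s i ≤ 1 := by
  rw [fillRate]
  split_ifs with h'
  · exact le_rfl
  · have h1 : (s.ext i : ℝ) < cap i := by exact_mod_cast not_le.1 h'
    have h2 : (s.ext i : ℝ) + s.int i ≤ cap i := by exact_mod_cast h
    rw [div_le_one (by linarith)]; linarith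

theorem fillRate_eq_one {s : Counters n} {i : Fin n} (h : s.ext i + s.int i = cap i) :
    fillRate cap s i = 1 := by
  rw [fillRate]
  split_ifs with h'
  · rfl
  · have h1 : (s.ext i : ℝ) < cap i := by exact_mod_cast not_le.1 h'
    have h2 : (s.ext i : ℝ) + s.int i = cap i := by exact_mod_cast h
    rw [div_eq_one_iff_eq (by linarith)]; linarith

theorem add_lt_of_fillRate_lt_one {s : Counters n} {i : Fin n} (h : s.ext i + s.int i ≤ cap i)
    (hf : fillRate cap s i < 1) : s.ext i + s.int i < cap i :=
  lt_of_le_of_ne h fun he => hf.ne (fillRate_eq_one he)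

theorem div_le_fillRate {s : Counters n} {i : Fin n} (h : s.ext i + s.int i ≤ cap i) :
    (s.int i : ℝ) / cap i ≤ fillRate cap s i := by
  have h2 : (s.ext i : ℝ) + s.int i ≤ cap i := by exact_mod_cast h
  have h0 : (0 : ℝ) ≤ s.ext i := by positivity
  rw [fillRate]
  split_ifs with h'
  · exact div_le_one_of_le₀ (by linarith) (by positivity)
  · have h1 : (s.ext i : ℝ) < cap i := by exact_mod_cast not_le.1 h'
    exact div_le_div_of_nonneg_left (by positivity) (by linarith) (by linarith)

theorem fillRate_mono {s s' : Counters n} {i : Fin n} (h : s.ext i + s.int i ≤ cap i)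
    (he : s.ext i ≤ s'.ext i) (hi : s.int i ≤ s'.int i) :
    fillRate cap s i ≤ fillRate cap s' i := by
  by_cases h' : cap i ≤ s'.ext i
  · refine (fillRate_le_one h).trans_eq ?_
    rw [fillRate, if_pos h']
  · rw [fillRate, fillRate, if_neg h', if_neg (by omega)]
    have h1 : (s'.ext i : ℝ) < cap i := by exact_mod_cast not_le.1 h'
    have h2 : (s.ext i : ℝ) ≤ s'.ext i := by exact_mod_cast he
    have h3 : (s.int i : ℝ) ≤ s'.int i := by exact_mod_cast hi
    exact div_le_div₀ (by positivity) h3 (by linarith) (by linarith)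

theorem fillRate_update_mono (a : Volunteer n × Option (Fin n)) {s : Counters n} {i : Fin n}
    (h : s.ext i + s.int i ≤ cap i) :
    fillRate cap s i ≤ fillRate cap (Counters.update cap a s) i := by
  refine fillRate_mono h ?_ ?_ <;> simp only [Counters.update] <;> split <;> simp only <;> omega

/-- The recommendation of the Adaptive Capacity algorithm maximizes the weight, and has positive
weight unless it is the dummy. -/
theorem adaptiveCapacity_spec (H : History n) {v : Volunteer n} (hv : v.target = none) :
    (∀ r, acWeight cap (counters cap H) v r ≤
        acWeight cap (counters cap H) v (adaptiveCapacity n cap H v)) ∧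
      ∀ i, adaptiveCapacity n cap H v = some i →
        0 < acWeight cap (counters cap H) v (some i) := by
  set f := acWeight cap (counters cap H) v with hf
  set l : List (Option (Fin n)) := none :: (List.finRange n).map some with hl
  have hr : adaptiveCapacity n cap H v = (List.argmax f l).getD none := by
    simp only [adaptiveCapacity, hv, hf, hl]
  have hmem : ∀ r, r ∈ l := by
    rintro (_ | i) <;> simp [hl]
  obtain ⟨m, hm⟩ : ∃ m, List.argmax f l = some m := by
    cases h : List.argmax f l with
    | none => simp [hl, List.argmax_eq_none] at h
    | some m => exact ⟨m, rfl⟩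
  rw [hr, hm]
  obtain ⟨-, h1, h2⟩ := List.argmax_eq_some_iff.1 hm
  refine ⟨fun r => h1 r (hmem r), fun i hi => ?_⟩
  obtain rfl : m = some i := hi
  by_contra hc
  -- The dummy heads the list with weight zero, so the tie-break would select it over any `some i`
  -- of nonpositive weight.
  have := h2 none (hmem none) (not_lt.1 hc)
  simp [hl] at this

end Counters

/-! ### The state of AC along a sample path. -/

namespace Problem

variable {I : Problem}

variable (I) in
/-- The Adaptive Capacity algorithm as a policy for the instance. -/
noncomputable abbrev ac : Policy I.n := adaptiveCapacity I.n I.cap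

/-- The counters after the first `t` arrivals under the Adaptive Capacity algorithm. -/
noncomputable def state (ω : I.Path) (t : ℕ) : Counters I.n := counters I.cap (I.history I.ac ω t)

theorem state_add_le (ω : I.Path) (t : ℕ) (i : Fin I.n) :
    (state ω t).ext i + (state ω t).int i ≤ I.cap i := counters_add_le _ _ _

theorem state_succ (ω : I.Path) {t : ℕ} (h : t < I.T) :
    state ω (t + 1) = Counters.update I.cap (I.vol ⟨t, h⟩,
      decision (I.vol ⟨t, h⟩) (ω ⟨t, h⟩) (I.ac (I.history I.ac ω t) (I.vol ⟨t, h⟩)))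
        (state ω t) := by
  rw [state, history_succ _ _ h]; rfl

theorem fillRate_state_mono (ω : I.Path) (i : Fin I.n) {t : ℕ} (ht : t ≤ I.T) :
    fillRate I.cap (state ω t) i ≤ fillRate I.cap (state ω I.T) i := by
  induction ht using Nat.decreasingInduction with
  | self => exact le_rfl
  | of_succ t h ih =>
    refine le_trans ?_ ih
    rw [state_succ ω h]
    exact fillRate_update_mono _ (state_add_le ω t i)

/-- A sign-up of internal traffic happens only at opportunities that are not full. -/
theorem add_lt_of_recommended (ω : I.Path) {t : Fin I.T} {i : Fin I.n}
    (ht : (I.vol t).target = none) (h : I.ac (I.history I.ac ω t) (I.vol t) = some i) :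
    (state ω t).ext i + (state ω t).int i < I.cap i := by
  have := (adaptiveCapacity_spec (I.history I.ac ω t) ht).2 i h
  refine add_lt_of_fillRate_lt_one (state_add_le ω t i) ?_
  by_contra hc
  have h1 : psi (fillRate I.cap (state ω t) i) ≤ psi 1 := psi_antitone (not_lt.1 hc)
  rw [psi_one] at h1
  have h2 := mul_nonpos_of_nonneg_of_nonpos ((I.vol t).μ_mem i).1 h1
  exact absurd this (not_lt.2 h2)

/-- The truncation in the counter never takes effect: AC sends internal traffic only to
opportunities that are not full. -/
theorem state_int_succ (ω : I.Path) (t : Fin I.T) (i : Fin I.n) :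
    ((state ω (t + 1)).int i : ℝ) = (state ω t).int i + signup I.ac ω t i := by
  rw [state_succ ω t.2]
  have hd := decision_indicator I.ac ω t i
  simp only [Counters.update, targets] at hd ⊢
  cases h : (I.vol t).target with
  | some j => simp [signup, recommends, h]
  | none =>
    simp only [h, reduceCtorEq, if_false, zero_add] at hd ⊢
    rw [← hd]
    have hle := state_add_le ω t i
    split_ifs with h1
    · have hrec : I.ac (I.history I.ac ω t) (I.vol t) = some i := by
        simp only [decision, h] at h1
        split at h1
        · rename_i j hj
          split_ifs at h1
          rw [hj, h1]
        · simp at h1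
      have := add_lt_of_recommended ω h hrec
      rw [min_eq_right (by omega)]
      push_cast; ring
    · rw [min_eq_right (by omega)]
      simp

theorem state_int (ω : I.Path) (i : Fin I.n) :
    ∀ t ≤ I.T, ((state ω t).int i : ℝ) = partialSum (fun t => signup I.ac ω t i) t := by
  refine horizon_induction ?_ ?_
  · simp [state, history, counters, partialSum_zero]
  · intro t ht ih
    rw [partialSum_succ _ ht, ← ih]
    exact state_int_succ ω ⟨t, ht⟩ i

/-- External arrivals are lost only at full opportunities, and these stay full. At the end either
`psi` vanishes at the fill rate or the external fill is the full `min` of capacity and external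
arrivals; this dichotomy closes the accounting. -/
theorem state_ext (ω : I.Path) (i : Fin I.n) : ∀ t ≤ I.T,
    ((state ω t).ext i : ℝ) ≤ partialSum (fun t => targets t i) t ∧
      ((state ω t).ext i + (state ω t).int i = I.cap i ∨
        ((state ω t).ext i : ℝ) = partialSum (fun t => targets t i) t) := by
  refine horizon_induction ?_ ?_
  · simp [state, history, counters, partialSum_zero]
  · intro t ht ⟨ih1, ih2⟩
    have hle := state_add_le ω t i
    rw [partialSum_succ _ ht, state_succ ω ht]
    have hd := decision_indicator I.ac ω ⟨t, ht⟩ i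
    simp only [Counters.update]
    cases h : (I.vol ⟨t, ht⟩).target with
    | some j =>
      have hs : signup I.ac ω ⟨t, ht⟩ i = 0 := by simp [signup, recommends, h]
      rw [hs, add_zero] at hd
      rw [← hd]
      simp only
      split_ifs with h1
      · rcases ih2 with ih2 | ih2
        · rw [min_eq_left (by omega)]
          have e : I.cap i - (state ω t).int i = (state ω t).ext i := by omega
          rw [e]
          exact ⟨by linarith, Or.inl ih2⟩
        · rcases hle.eq_or_lt with h2 | h2
          · rw [min_eq_left (by omega)]
            have e : I.cap i - (state ω t).int i = (state ω t).ext i := by omega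
            rw [e]
            exact ⟨by linarith, Or.inl h2⟩
          · rw [min_eq_right (by omega), ← ih2]
            push_cast
            exact ⟨le_rfl, Or.inr rfl⟩
      · rw [min_eq_right (by omega)]
        simpa using ⟨ih1, ih2⟩
    | none =>
      have hs : targets ⟨t, ht⟩ i = 0 := by simp [targets, h]
      rw [hs, add_zero]
      simp only
      refine ⟨ih1, ih2.imp_left fun h2 => ?_⟩
      split_ifs <;> omega

theorem state_ext_le (ω : I.Path) (i : Fin I.n) :
    ((state ω I.T).ext i : ℝ) ≤ min (I.cap i : ℝ) (I.external i) := by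
  have := (state_ext ω i I.T le_rfl).1
  rw [partialSum_T, sum_targets] at this
  refine le_min ?_ this
  have := state_add_le ω I.T i
  exact_mod_cast (by omega : (state ω I.T).ext i ≤ I.cap i)

theorem state_full_or (ω : I.Path) (i : Fin I.n) :
    (state ω I.T).ext i + (state ω I.T).int i = I.cap i ∨
      ((state ω I.T).ext i : ℝ) = min (I.cap i : ℝ) (I.external i) := by
  refine (state_ext ω i I.T le_rfl).2.imp_right fun h => ?_
  rw [partialSum_T, sum_targets] at h
  refine le_antisymm (state_ext_le ω i) ?_
  rw [h]; exact min_le_right _ _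

variable (I) in
theorem value_ac : I.value I.ac =
    I.expect fun ω => ∑ i, (((state ω I.T).ext i : ℝ) + (state ω I.T).int i) := by
  rw [value]
  congr 1; ext ω
  refine Finset.sum_congr rfl fun i _ => ?_
  have := counters_add I.cap (I.history I.ac ω I.T) i
  rw [signups]
  exact_mod_cast this.symm

/-! ### Splitting the weighted fill into rewards. -/

/-- The part of the internal fill of `i` weighted by `Y`. -/
noncomputable def weightedFill (Y : Fin I.T → ℝ) (ω : I.Path) (i : Fin I.n) : ℝ :=
  ∑ t, Y t * signup I.ac ω t i

variable {Y : Fin I.T → ℝ}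

theorem weightedFill_nonneg (hY : ∀ t, 0 ≤ Y t) (ω : I.Path) (i : Fin I.n) :
    0 ≤ weightedFill Y ω i :=
  Finset.sum_nonneg fun t _ => mul_nonneg (hY t) (signup_nonneg _ _ _ _)

theorem weightedFill_le (hY : ∀ t, Y t ≤ 1) (ω : I.Path) (i : Fin I.n) :
    weightedFill Y ω i ≤ (state ω I.T).int i := by
  rw [state_int ω i _ le_rfl, partialSum_T]
  exact Finset.sum_le_sum fun t _ => mul_le_of_le_one_left (signup_nonneg _ _ _ _) (hY t)

theorem signup_eq_zero_or_one (π : Policy I.n) (ω : I.Path) (t : Fin I.T) (i : Fin I.n) :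
    signup π ω t i = 0 ∨ signup π ω t i = 1 := by
  simp only [signup, recommends]; split_ifs <;> simp

/-- The part of the rewards that is credited to an opportunity. -/
theorem credited_reward (hc : ∀ i, 0 < I.cap i) (hY0 : ∀ t, 0 ≤ Y t) (hY1 : ∀ t, Y t ≤ 1)
    (ω : I.Path) (i : Fin I.n) :
    Real.exp (-1 / (I.cap i : ℝ)) * (I.cap i *
        (Real.exp (weightedFill Y ω i / I.cap i - 1) - Real.exp (-1))) ≤
      ∑ t : Fin I.T, Y t * (signup I.ac ω t i *
        (1 - psi (fillRate I.cap (state ω t) i))) := by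
  have hc' : (0 : ℝ) < I.cap i := by exact_mod_cast hc i
  -- The first invariant lets `exp_step` apply: the potential is evaluated at the weighted fill,
  -- whereas the reward depends on the fill rate, which is at least the internal fill over capacity.
  have key : ∀ t ≤ I.T,
      partialSum (fun t => Y t * signup I.ac ω t i) t ≤ (state ω t).int i ∧
      Real.exp (-1 / (I.cap i : ℝ)) * (I.cap i *
        (Real.exp (partialSum (fun t => Y t * signup I.ac ω t i) t / I.cap i - 1) -
          Real.exp (-1))) ≤
        partialSum (fun t => Y t * (signup I.ac ω t i *
          (1 - psi (fillRate I.cap (state ω t) i)))) t := by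
    refine horizon_induction ?_ ?_
    · simp [partialSum_zero]
    · intro t ht ⟨ih1, ih2⟩
      rw [partialSum_succ _ ht, partialSum_succ _ ht]
      rw [state_int_succ ω ⟨t, ht⟩ i]
      rcases signup_eq_zero_or_one I.ac ω ⟨t, ht⟩ i with h | h
      · simpa [h] using ⟨ih1, ih2⟩
      · simp only [h, mul_one, one_mul]
        refine ⟨by linarith [hY1 ⟨t, ht⟩], ?_⟩
        have hst := exp_step hc' ih1 (hY0 ⟨t, ht⟩) (hY1 ⟨t, ht⟩)
        have hfr := div_le_fillRate (state_add_le ω t i)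
        have : Real.exp ((state ω t).int i / (I.cap i : ℝ) - 1) ≤
            1 - psi (fillRate I.cap (state ω t) i) := by
          simp only [psi, sub_sub_cancel]
          exact Real.exp_le_exp.2 (by linarith)
        have := mul_le_mul_of_nonneg_left this (hY0 ⟨t, ht⟩)
        simp only [mul_sub] at *
        linarith
  have := (key I.T le_rfl).2
  rwa [partialSum_T, partialSum_T] at this

theorem sum_recommends_weight (ω : I.Path) {t : Fin I.T} (ht : (I.vol t).target = none)
    (j : Fin I.n) : (I.vol t).μ j * psi (fillRate I.cap (state ω t) j) ≤
      ∑ i, recommends I.ac ω t i *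
        ((I.vol t).μ i * psi (fillRate I.cap (state ω t) i)) := by
  have h1 := (adaptiveCapacity_spec (cap := I.cap) (I.history I.ac ω t) ht).1 (some j)
  refine h1.trans (le_of_eq ?_)
  simp only [recommends, ht, true_and]
  cases h : I.ac (I.history I.ac ω t) (I.vol t) with
  | none =>
    rw [show adaptiveCapacity I.n I.cap (I.history I.ac ω t) (I.vol t) = none from h]
    simp [acWeight]
  | some k =>
    rw [show adaptiveCapacity I.n I.cap (I.history I.ac ω t) (I.vol t) = some k from h]
    simp [acWeight, state]

variable {y : Fin I.T → Fin I.n → ℝ}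

/-- The rewards credited to the volunteers pay for the fractional assignment `y`. -/
theorem volunteer_reward (hy0 : ∀ t i, 0 ≤ y t i)
    (hyi : ∀ t i, y t i ≠ 0 → (I.vol t).target = none ∧ 0 < (I.vol t).μ i) :
    I.expect (fun ω => ∑ i, (∑ t, (I.vol t).μ i * y t i) *
        psi (fillRate I.cap (state ω I.T) i)) ≤
      I.expect fun ω => ∑ i, ∑ t : Fin I.T, (∑ j, y t j) * (signup I.ac ω t i *
        psi (fillRate I.cap (state ω t) i)) := by
  have hR : I.expect (fun ω => ∑ i, ∑ t : Fin I.T, (∑ j, y t j) * (signup I.ac ω t i *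
        psi (fillRate I.cap (state ω t) i))) =
      I.expect fun ω => ∑ t : Fin I.T, (∑ j, y t j) * ∑ i, recommends I.ac ω t i *
        ((I.vol t).μ i * psi (fillRate I.cap (state ω t) i)) := by
    simp only [Finset.mul_sum]
    rw [expect_sum]
    simp only [expect_sum]
    rw [Finset.sum_comm]
    refine Finset.sum_congr rfl fun t _ => Finset.sum_congr rfl fun i _ => ?_
    rw [expect_mul_left, expect_mul_left]
    congr 1
    have := expect_signup_mul I.ac t i fun H => psi (fillRate I.cap (counters I.cap H) i)
    refine this.trans ?_
    rw [← expect_mul_left]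
    congr 1; ext ω; simp only [state]; ring
  rw [hR]
  refine expect_mono fun ω => ?_
  simp only [Finset.sum_mul]
  rw [Finset.sum_comm]
  refine Finset.sum_le_sum fun t _ => Finset.sum_le_sum fun i _ => ?_
  by_cases h : y t i = 0
  · simp [h]
  · have hw := sum_recommends_weight ω (hyi t i h).1 i
    have hm := psi_antitone (fillRate_state_mono ω i t.2.le)
    have hμ := ((I.vol t).μ_mem i).1
    calc (I.vol t).μ i * y t i * psi (fillRate I.cap (state ω I.T) i)
        = y t i * ((I.vol t).μ i * psi (fillRate I.cap (state ω I.T) i)) := by ring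
      _ ≤ y t i * ((I.vol t).μ i * psi (fillRate I.cap (state ω t) i)) :=
        mul_le_mul_of_nonneg_left (mul_le_mul_of_nonneg_left hm hμ) (hy0 t i)
      _ ≤ _ := mul_le_mul_of_nonneg_left hw (hy0 t i)

/-- The internal fill of the Adaptive Capacity algorithm splits into the reward credited to the
opportunities and the reward that pays for the assignment `y`. -/
theorem reward_le_weightedFill (hc : ∀ i, 0 < I.cap i) (hy0 : ∀ t i, 0 ≤ y t i)
    (hy1 : ∀ t, ∑ i, y t i ≤ 1)
    (hyi : ∀ t i, y t i ≠ 0 → (I.vol t).target = none ∧ 0 < (I.vol t).μ i) :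
    I.expect (fun ω => ∑ i, (Real.exp (-1 / (I.cap i : ℝ)) * (I.cap i *
        (Real.exp (weightedFill (fun t => ∑ j, y t j) ω i / I.cap i - 1) - Real.exp (-1))) +
        (min (I.cap i : ℝ) (I.external i) + ∑ t, (I.vol t).μ i * y t i -
          (state ω I.T).ext i) * psi (fillRate I.cap (state ω I.T) i))) ≤
      I.expect fun ω => ∑ i, weightedFill (fun t => ∑ j, y t j) ω i := by
  have hY0 : ∀ t, 0 ≤ ∑ j, y t j := fun t => Finset.sum_nonneg fun j _ => hy0 t j
  have h1 : I.expect (fun ω => ∑ i, weightedFill (fun t => ∑ j, y t j) ω i) =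
      I.expect (fun ω => ∑ i, ∑ t : Fin I.T, (∑ j, y t j) * (signup I.ac ω t i *
        (1 - psi (fillRate I.cap (state ω t) i)))) +
      I.expect (fun ω => ∑ i, ∑ t : Fin I.T, (∑ j, y t j) * (signup I.ac ω t i *
        psi (fillRate I.cap (state ω t) i))) := by
    rw [← expect_add]
    congr 1; ext ω
    rw [← Finset.sum_add_distrib]
    refine Finset.sum_congr rfl fun i _ => ?_
    rw [weightedFill, ← Finset.sum_add_distrib]
    exact Finset.sum_congr rfl fun t _ => by ring
  rw [h1]
  refine le_trans ?_ (add_le_add_right (volunteer_reward hy0 hyi) _)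
  rw [← expect_add]
  refine expect_mono fun ω => ?_
  rw [← Finset.sum_add_distrib]
  refine Finset.sum_le_sum fun i _ => add_le_add (credited_reward hc hY0 hy1 ω i) (le_of_eq ?_)
  -- At a full opportunity both sides vanish since `psi 1 = 0`; otherwise the final external fill
  -- cancels the external part of the optimal fill.
  rcases state_full_or ω i with h | h
  · rw [fillRate_eq_one h, psi_one]; ring
  · rw [h]; ring

/-- Internal sign-ups, weighted by the load of `y`, are at most `σ` times those of `y`. -/
theorem expect_weightedFill_le {σ : ℝ} (hy0 : ∀ t i, 0 ≤ y t i)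
    (hyi : ∀ t i, y t i ≠ 0 → (I.vol t).target = none ∧ 0 < (I.vol t).μ i)
    (hσ : ∀ t i j, 0 < (I.vol t).μ i → (I.vol t).μ j ≤ σ * (I.vol t).μ i) (hσ0 : 0 ≤ σ) :
    I.expect (fun ω => ∑ i, weightedFill (fun t => ∑ j, y t j) ω i) ≤
      σ * ∑ i, ∑ t, (I.vol t).μ i * y t i := by
  simp only [weightedFill]
  rw [expect_sum]
  simp only [expect_sum, expect_mul_left, expect_signup]
  rw [Finset.sum_comm, Finset.sum_comm (f := fun i t => (I.vol t).μ i * y t i), Finset.mul_sum]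
  refine Finset.sum_le_sum fun t _ => ?_
  have : ∑ i, (∑ j, y t j) * ((I.vol t).μ i * I.expect fun ω => recommends I.ac ω t i) =
      I.expect fun ω => ∑ i, recommends I.ac ω t i * ((∑ j, y t j) * (I.vol t).μ i) := by
    rw [expect_sum]
    refine Finset.sum_congr rfl fun i _ => ?_
    rw [← mul_assoc, ← expect_mul_left]
    congr 1; ext ω; ring
  rw [this]
  refine (expect_mono fun ω => ?_).trans_eq (expect_const _)
  refine sum_recommends_mul_le _ _ _ _ ?_ ?_
  · exact mul_nonneg hσ0 (Finset.sum_nonneg fun i _ =>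
      mul_nonneg ((I.vol t).μ_mem i).1 (hy0 t i))
  · intro i
    rw [Finset.sum_mul, Finset.mul_sum]
    refine Finset.sum_le_sum fun j _ => ?_
    -- Wherever `y t j` is positive, so is `μ j`, and the conversion probability of any
    -- recommendation of AC is at most `σ` times it.
    by_cases h : y t j = 0
    · simp [h]
    · have := mul_le_mul_of_nonneg_left (hσ t j i (hyi t j h).2) (hy0 t j)
      linarith

end Problem

/-! ### Averaging over paths and opportunities. -/

/-- The scaled form of `exists_gFun_le` for an opportunity with capacity `C`, optimal fill `o`,
external fill `E`, internal fill `N` of which the part `A` is weighted, and fill rate `f`. -/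
theorem exists_simplex_point {C o E N A f : ℝ} (hC : 0 < C) (hE : 0 ≤ E) (hEo : E ≤ o)
    (hoC : o ≤ C) (hA : 0 ≤ A) (hAN : A ≤ N) (hsum : E + N ≤ C)
    (hf : E < C → f = N / (C - E)) :
    ∃ P ∈ simplexDomain, ∃ ex : ℝ, 0 ≤ ex ∧ ex ≤ E + N - A ∧
      o * (P.1 + P.2) ≤ E + N - ex ∧ E + N - A - ex ≤ o * P.1 ∧
      o * gFun P ≤ E + N - A - ex + C * (Real.exp (A / C - 1) - Real.exp (-1)) +
        (o - E) * psi f := by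
  rcases (hE.trans hEo).eq_or_lt with h | h
  · have hE0 : E = 0 := by linarith
    refine ⟨(0, 0), ⟨le_rfl, le_rfl, by norm_num⟩, E + N - A, by linarith, le_rfl, by linarith,
      by linarith, ?_⟩
    have : Real.exp (-1) ≤ Real.exp (A / C - 1) := Real.exp_le_exp.2 (by
      have : 0 ≤ A / C := by positivity
      linarith)
    rw [← h, hE0]
    have := mul_nonneg hC.le (sub_nonneg.2 this)
    linarith
  obtain ⟨P, hP, ex, h1, h2, h3, h4, h5⟩ := exists_gFun_le (x := E / C) (w := (N - A) / C)
    (y := A / C) (o := o / C) (by positivity) (div_nonneg (by linarith) hC.le) (by positivity)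
    (by gcongr) (by positivity) ((div_le_one hC).2 hoC)
    (by rw [← add_div, ← add_div, div_le_one hC]; linarith)
  have e0 : ∀ z : ℝ, C * (z / C) = z := fun z => by field_simp
  have e1 : C * (o / C) = o := e0 o
  refine ⟨P, hP, C * ex, by positivity, ?_, ?_, ?_, ?_⟩
  · have := mul_le_mul_of_nonneg_left h2 hC.le
    rw [mul_add, e0, e0] at this; linarith
  · have := mul_le_mul_of_nonneg_left h3 hC.le
    rw [← mul_assoc, e1, mul_sub, mul_add C, mul_add C, e0, e0, e0] at this; linarith
  · have := mul_le_mul_of_nonneg_left h4 hC.le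
    rw [← mul_assoc, e1, mul_sub, mul_add, e0, e0] at this; linarith
  · have := mul_le_mul_of_nonneg_left h5 hC.le
    have e2 : C * ((o / C - E / C) * psi ((A / C + (N - A) / C) / (1 - E / C))) =
        (o - E) * psi f := by
      rw [← mul_assoc, mul_sub, e0, e0]
      -- If external traffic fills everything, the value of `f` is irrelevant because `o - E = 0`.
      rcases (hEo.trans hoC).eq_or_lt with h' | h'
      · have : o - E = 0 := by linarith
        rw [this, zero_mul, zero_mul]
      · rw [hf h']
        have : C - E ≠ 0 := by linarith
        have e3 : (A / C + (N - A) / C) / (1 - E / C) = N / (C - E) := by field_simp; ring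
        rw [e3]
    rw [← mul_assoc, e1, mul_add, e2, mul_add, mul_sub, mul_add, e0, e0] at this
    linarith

/-- Jensen's inequality for the envelope. -/
theorem gEnv_sum_le {ι : Type*} (s : Finset ι) (w : ι → ℝ) (P : ι → ℝ × ℝ)
    (hw : ∀ i ∈ s, 0 ≤ w i) (hw1 : ∑ i ∈ s, w i = 1) (hP : ∀ i ∈ s, P i ∈ simplexDomain) :
    gEnv (∑ i ∈ s, w i • P i) ≤ ∑ i ∈ s, w i * gFun (P i) := by
  refine gEnv_le fun h hc hg => (hc.map_sum_le hw hw1 hP).trans ?_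
  exact Finset.sum_le_sum fun i hi => mul_le_mul_of_nonneg_left (hg _ (hP i hi)) (hw i hi)

namespace Problem

variable {I : Problem}

theorem conversion_ratio_le {σ : ℝ} (hI : I.mcpr ≤ σ) (hσ : 0 ≤ σ) (t : Fin I.T)
    (i j : Fin I.n) (hi : 0 < (I.vol t).μ i) : (I.vol t).μ j ≤ σ * (I.vol t).μ i := by
  rcases ((I.vol t).μ_mem j).1.eq_or_lt with h | h
  · rw [← h]; positivity
  have hc : I.cpr t ≤ σ := (le_ciSup (f := I.cpr) (Set.finite_range _).bddAbove t).trans hI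
  set f : {i : Fin I.n // 0 < (I.vol t).μ i} → ℝ := fun i => (I.vol t).μ i with hf
  have : Nonempty {i : Fin I.n // 0 < (I.vol t).μ i} := ⟨⟨i, hi⟩⟩
  have h1 : (I.vol t).μ j ≤ ⨆ i, f i := le_ciSup (Set.finite_range f).bddAbove ⟨j, h⟩
  have h2 : ⨅ i, f i ≤ (I.vol t).μ i := ciInf_le (Set.finite_range f).bddBelow ⟨i, hi⟩
  obtain ⟨k, hk⟩ := exists_eq_ciInf_of_finite (f := f)
  have h3 : 0 < ⨅ i, f i := hk ▸ k.2
  have h4 : (⨆ i, f i) / (⨅ i, f i) ≤ σ := hc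
  rw [div_le_iff₀ h3] at h4
  nlinarith

theorem value_le_sum_cap (π : Policy I.n) : I.value π ≤ ∑ i, (I.cap i : ℝ) :=
  (value_le π).trans (Finset.sum_le_sum fun _ _ => min_le_left _ _)

theorem value_nonneg (π : Policy I.n) : 0 ≤ I.value π :=
  expect_nonneg fun _ => Finset.sum_nonneg fun _ _ => le_min (by positivity) (by positivity)

/-- The Adaptive Capacity algorithm fills all the capacity that external traffic can fill. -/
theorem sum_min_external_le_value_ac :
    ∑ i, min (I.cap i : ℝ) (I.external i) ≤ I.value I.ac := by
  rw [value_ac]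
  refine (expect_const _).symm.trans_le (expect_mono fun ω => Finset.sum_le_sum fun i _ => ?_)
  rcases state_full_or ω i with h | h
  · have : ((state ω I.T).ext i : ℝ) + (state ω I.T).int i = I.cap i := by exact_mod_cast h
    rw [this]; exact min_le_left _ _
  · rw [h]
    have : (0 : ℝ) ≤ (state ω I.T).int i := by positivity
    linarith

theorem efet_mul (h : 0 < ∑ i, (I.cap i : ℝ)) :
    I.efet * ∑ i, (I.cap i : ℝ) = ∑ i, min (I.cap i : ℝ) (I.external i) := by
  rw [efet, div_mul_cancel₀ _ h.ne']

/-- The Adaptive Capacity algorithm attains the fraction `zStar` of the value of every policy. -/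
theorem zStar_mul_value_le {β σ : ℝ} {c : ℕ} (hβ : β ∈ Set.Icc (0 : ℝ) 1) (hσ : 1 ≤ σ)
    (hc : 1 ≤ c) (hI : I ∈ instanceClass β c σ) (π : Policy I.n) :
    zStar β c σ * I.value π ≤ I.value I.ac := by
  obtain ⟨hefet, hleast, hmcpr⟩ := hI
  have hz := zStar_isLeast c hβ.2 hσ
  have hcap : ∀ i, c ≤ I.cap i := fun i => hleast.2 ⟨i, rfl⟩
  have hcap0 : ∀ i, 0 < I.cap i := fun i => lt_of_lt_of_le hc (hcap i)
  have hcapR : ∀ i, (0 : ℝ) < I.cap i := fun i => by exact_mod_cast hcap0 i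
  obtain ⟨y, hy0, hy1, hyi, hyc, hyv⟩ := exists_fractional π
  set Y : Fin I.T → ℝ := fun t => ∑ j, y t j with hY
  have hY0 : ∀ t, 0 ≤ Y t := fun t => Finset.sum_nonneg fun j _ => hy0 t j
  set e : Fin I.n → ℝ := fun i => min (I.cap i : ℝ) (I.external i) with he
  set o : Fin I.n → ℝ := fun i => e i + ∑ t, (I.vol t).μ i * y t i with ho
  have hoe : ∀ i, e i ≤ o i := fun i => le_add_of_nonneg_right
    (Finset.sum_nonneg fun t _ => mul_nonneg ((I.vol t).μ_mem i).1 (hy0 t i))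
  have he0 : ∀ i, 0 ≤ e i := fun i => le_min (by positivity) (by positivity)
  have ho0 : ∀ i, 0 ≤ o i := fun i => (he0 i).trans (hoe i)
  set O : ℝ := ∑ i, o i with hO
  rcases (Finset.sum_nonneg fun i _ => ho0 i : 0 ≤ ∑ i, o i).eq_or_lt with hO0 | hO0
  · have : I.value π = 0 := le_antisymm (hyv.trans hO0.symm.le) (value_nonneg π)
    rw [this, mul_zero]; exact value_nonneg _
  rw [← hO] at hO0
  have hpt : ∀ (ω : I.Path) (i : Fin I.n), ∃ P ∈ simplexDomain, ∃ ex : ℝ, 0 ≤ ex ∧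
      ex ≤ (state ω I.T).ext i + (state ω I.T).int i - weightedFill Y ω i ∧
      o i * (P.1 + P.2) ≤ (state ω I.T).ext i + (state ω I.T).int i - ex ∧
      (state ω I.T).ext i + (state ω I.T).int i - weightedFill Y ω i - ex ≤ o i * P.1 ∧
      o i * gFun P ≤ (state ω I.T).ext i + (state ω I.T).int i - weightedFill Y ω i - ex +
        I.cap i * (Real.exp (weightedFill Y ω i / I.cap i - 1) - Real.exp (-1)) +
        (o i - (state ω I.T).ext i) * psi (fillRate I.cap (state ω I.T) i) := by
    intro ω i
    refine exists_simplex_point (hcapR i) (by positivity) ((state_ext_le ω i).trans (hoe i))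
      (hyc i) (weightedFill_nonneg hY0 ω i) (weightedFill_le hy1 ω i) ?_ ?_
    · exact_mod_cast state_add_le ω I.T i
    · intro h
      rw [fillRate, if_neg (not_le.2 (by exact_mod_cast h))]
  choose P hP ex hex0 hex1 hPs hP1 hPg using hpt
  set κ : ℝ := Real.exp (-1 / (c : ℝ)) with hκ
  have hκ0 : 0 < κ := Real.exp_pos _
  have hκ1 : κ ≤ 1 := exp_neg_one_div_le_one c
  have hκi : ∀ i, κ ≤ Real.exp (-1 / (I.cap i : ℝ)) := by
    intro i
    refine Real.exp_le_exp.2 ?_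
    have : (c : ℝ) ≤ I.cap i := by exact_mod_cast hcap i
    have hc0 : (0 : ℝ) < c := by exact_mod_cast hc
    rw [neg_div, neg_div, neg_le_neg_iff]
    exact one_div_le_one_div_of_le hc0 this
  set V : ℝ := I.value I.ac with hV
  set X : ℝ := I.expect fun ω => ∑ i, ex ω i with hX
  set A : ℝ := I.expect fun ω => ∑ i, weightedFill Y ω i with hA
  have hX0 : 0 ≤ X := expect_nonneg fun ω => Finset.sum_nonneg fun i _ => hex0 ω i
  have hVX : V - X = I.expect fun ω => ∑ i, ((state ω I.T).ext i + (state ω I.T).int i -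
      ex ω i) := by
    rw [hV, hX, value_ac, ← expect_sub]
    simp only [Finset.sum_sub_distrib]
  have hVAX : V - A - X = I.expect fun ω => ∑ i, ((state ω I.T).ext i + (state ω I.T).int i -
      weightedFill Y ω i - ex ω i) := by
    rw [hV, hX, hA, value_ac, ← expect_sub, ← expect_sub]
    simp only [Finset.sum_sub_distrib]
  -- A probability distribution on pairs (path, opportunity), proportional to optimal fill, so that
  -- a single use of Jensen's inequality covers both averages.
  set wt : I.Path × Fin I.n → ℝ := fun q => I.prob q.1 * o q.2 / O with hwt
  have hwt0 : ∀ q ∈ (Finset.univ : Finset (I.Path × Fin I.n)), 0 ≤ wt q := fun q _ =>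
    div_nonneg (mul_nonneg (I.prob_nonneg _) (ho0 _)) hO0.le
  have hsum : ∀ F : I.Path → Fin I.n → ℝ,
      O * ∑ q, wt q * F q.1 q.2 = I.expect fun ω => ∑ i, o i * F ω i := by
    intro F
    rw [Fintype.sum_prod_type, Finset.mul_sum]
    simp only [expect, Finset.mul_sum]
    refine Finset.sum_congr rfl fun ω _ => Finset.sum_congr rfl fun i _ => ?_
    simp only [hwt]; field_simp
  have hwt1 : ∑ q, wt q = 1 := by
    have := hsum fun _ _ => 1
    simp only [mul_one, expect_const] at this
    rw [← hO] at this
    exact mul_left_cancel₀ hO0.ne' (this.trans (mul_one O).symm)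
  set p : ℝ × ℝ := ∑ q, wt q • P q.1 q.2 with hp
  have hpD : p ∈ simplexDomain := convex_simplexDomain.sum_mem hwt0 hwt1 fun q _ => hP _ _
  have hp1 : O * p.1 = I.expect fun ω => ∑ i, o i * (P ω i).1 := by
    rw [← hsum, hp, Prod.fst_sum]; simp
  have hp2 : O * p.2 = I.expect fun ω => ∑ i, o i * (P ω i).2 := by
    rw [← hsum, hp, Prod.snd_sum]; simp
  have hJ : O * gEnv p ≤ I.expect fun ω => ∑ i, o i * gFun (P ω i) := by
    rw [← hsum]
    exact mul_le_mul_of_nonneg_left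
      (gEnv_sum_le _ wt (fun q => P q.1 q.2) hwt0 hwt1 fun q _ => hP _ _) hO0.le
  have hps : O * (p.1 + p.2) ≤ V - X := by
    rw [mul_add, hp1, hp2, ← expect_add, hVX]
    refine expect_mono fun ω => ?_
    rw [← Finset.sum_add_distrib]
    exact Finset.sum_le_sum fun i _ => by rw [← mul_add]; exact hPs ω i
  have hp1' : V - A - X ≤ O * p.1 := by
    rw [hp1, hVAX]
    exact expect_mono fun ω => Finset.sum_le_sum fun i _ => hP1 ω i
  have hreward := reward_le_weightedFill hcap0 hy0 hy1 hyi
  have hgain : κ * (O * gEnv p) ≤ V - X := by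
    calc κ * (O * gEnv p) ≤ κ * I.expect fun ω => ∑ i, o i * gFun (P ω i) := by gcongr
      _ = I.expect fun ω => ∑ i, κ * (o i * gFun (P ω i)) := by
        rw [← expect_mul_left]; simp only [Finset.mul_sum]
      _ ≤ I.expect fun ω => ∑ i, ((state ω I.T).ext i + (state ω I.T).int i -
          weightedFill Y ω i - ex ω i) + ∑ i, (Real.exp (-1 / (I.cap i : ℝ)) * (I.cap i *
          (Real.exp (weightedFill Y ω i / I.cap i - 1) - Real.exp (-1))) +
          (o i - (state ω I.T).ext i) * psi (fillRate I.cap (state ω I.T) i)) := by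
        refine expect_mono fun ω => ?_
        rw [← Finset.sum_add_distrib]
        refine Finset.sum_le_sum fun i _ => ?_
        -- Only the potential term needs the factor `κ`; the other two terms are nonnegative, so
        -- they may be restored to full value.
        have a1 := mul_le_mul_of_nonneg_left (hPg ω i) hκ0.le
        have a2 := hex1 ω i
        have a3 : 0 ≤ (o i - (state ω I.T).ext i) * psi (fillRate I.cap (state ω I.T) i) :=
          mul_nonneg (sub_nonneg.2 ((state_ext_le ω i).trans (hoe i)))
            (psi_nonneg (fillRate_le_one (state_add_le ω I.T i)))
        have a4 : 0 ≤ (I.cap i : ℝ) *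
            (Real.exp (weightedFill Y ω i / I.cap i - 1) - Real.exp (-1)) := by
          refine mul_nonneg (hcapR i).le (sub_nonneg.2 (Real.exp_le_exp.2 ?_))
          have := div_nonneg (weightedFill_nonneg hY0 ω i) (hcapR i).le
          linarith
        have a5 := mul_le_mul_of_nonneg_right (hκi i) a4
        have a6 := mul_le_of_le_one_left a3 hκ1
        have a7 := mul_le_of_le_one_left (sub_nonneg.2 a2) hκ1
        rw [mul_add, mul_add] at a1
        have a8 : κ * ((state ω I.T).ext i + (state ω I.T).int i -
          weightedFill Y ω i - ex ω i) ≤ (state ω I.T).ext i + (state ω I.T).int i -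
          weightedFill Y ω i - ex ω i := a7
        linarith
      _ ≤ (V - A - X) + A := by
        rw [expect_add, ← hVAX]
        exact add_le_add_right hreward _
      _ = V - X := by ring
  have hS : 0 < ∑ i, (I.cap i : ℝ) := hO0.trans_le (Finset.sum_le_sum fun i _ => hyc i)
  -- The external fill is `β` times total capacity, hence at least `β * O`; then `σ * (1 - β) ≤ σ -
  -- β` because `σ ≥ 1`.
  have hAle : A ≤ (σ - β) * O := by
    have h1 := expect_weightedFill_le hy0 hyi
      (fun t i j => conversion_ratio_le hmcpr (by linarith) t i j) (by linarith)
    have h2 : ∑ i, ∑ t, (I.vol t).μ i * y t i = O - ∑ i, e i := by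
      rw [hO, ← Finset.sum_sub_distrib]
      exact Finset.sum_congr rfl fun i _ => by simp only [ho]; ring
    have h3 := efet_mul hS
    rw [hefet] at h3
    have h4 : β * O ≤ ∑ i, e i :=
      (mul_le_mul_of_nonneg_left (Finset.sum_le_sum fun i _ => hyc i) hβ.1).trans_eq h3
    rw [h2] at h1
    have h5 : A ≤ σ * (O - ∑ i, e i) := h1
    nlinarith [mul_nonneg hβ.1 hO0.le]
  set z : ℝ := (V - X) / O with hzdef
  have hzO : z * O = V - X := div_mul_cancel₀ _ hO0.ne'
  have hz1 : p.1 + p.2 ≤ z := by rw [hzdef, le_div_iff₀ hO0]; linarith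
  have hz2 : z - (σ - β) ≤ p.1 := by
    rw [hzdef, sub_le_iff_le_add, div_le_iff₀ hO0]; nlinarith
  have hz3 : κ * gEnv p ≤ z := by rw [hzdef, le_div_iff₀ hO0]; linarith
  have hz0 : 0 ≤ z := by linarith [hpD.1, hpD.2.1]
  have hzz : zStar β c σ ≤ z := by
    rcases le_or_gt z 1 with h | h
    · refine hz.2 (mem_feasible_of_le hβ.2 hσ ⟨hz0, h⟩ (le_trans ?_ hz3))
      refine mul_le_mul_of_nonneg_left ?_ hκ0.le
      -- The second coordinate is raised until the sum is `z`; mass is then traded from the first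
      -- coordinate down to `max 0 (β - σ + z)`. Neither move raises the envelope.
      have hr : gEnv (p.1, z - p.1) ≤ gEnv p := gEnv_anti_snd hpD (by linarith) (by linarith)
      refine le_trans (gEnv_trade (p := (p.1, z - p.1)) ⟨hpD.1, ?_, ?_⟩ (le_max_left _ _) ?_ ?_) hr
      · simp only; linarith [hpD.2.1]
      · simp only; linarith
      · exact max_le hpD.1 (by linarith)
      · simp
    · exact (hz.2 (one_mem_feasible c hβ.2 hσ)).trans h.le
  calc zStar β c σ * I.value π ≤ z * O :=
        mul_le_mul hzz hyv (value_nonneg π) hz0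
    _ = V - X := hzO
    _ ≤ V := by linarith

theorem efet_mul_value_le {β : ℝ} (hβ : 0 ≤ β) (hI : I.efet = β)
    (h : 0 < ∑ i, (I.cap i : ℝ)) (π : Policy I.n) : β * I.value π ≤ I.value I.ac := by
  have h3 := efet_mul h
  rw [hI] at h3
  exact (mul_le_mul_of_nonneg_left (value_le_sum_cap π) hβ).trans
    (h3.trans_le sum_min_external_le_value_ac)

end Problem
end MultiChannel

theorem theorem3 (β : ℝ) (hβ : β ∈ Set.Icc (0 : ℝ) 1) (c : ℕ) (hc : 1 ≤ c)
    (σ : ℝ) (hσ : 1 ≤ σ) :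
    IsLeast (MultiChannel.feasible β c σ) (MultiChannel.zStar β c σ) ∧
      ((max β (MultiChannel.zStar β c σ) : ℝ) : EReal) ≤
        MultiChannel.competitiveRatio MultiChannel.adaptiveCapacity
          (MultiChannel.instanceClass β c σ) := by
  refine ⟨MultiChannel.zStar_isLeast c hβ.2 hσ, ?_⟩
  refine le_iInf₂ fun I hI => EReal.coe_le_coe_iff.2 ?_
  obtain ⟨hI, hopt⟩ := hI
  have hS : 0 < ∑ i, (I.cap i : ℝ) :=
    hopt.trans_le (ciSup_le fun π => MultiChannel.Problem.value_le_sum_cap π)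
  have h0 : 0 ≤ max β (MultiChannel.zStar β c σ) := hβ.1.trans (le_max_left _ _)
  rw [le_div_iff₀ hopt, MultiChannel.Problem.opt, Real.mul_iSup_of_nonneg h0]
  refine ciSup_le fun π => ?_
  rcases max_choice β (MultiChannel.zStar β c σ) with h | h
  · rw [h]; exact MultiChannel.Problem.efet_mul_value_le hβ.1 hI.1 hS π
  · rw [h]; exact MultiChannel.Problem.zStar_mul_value_le hβ hσ hc hI π
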